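/- Let $Y_1,Y_2,\dots$ be independent real random variables, all from the same one of the following five families (the non-Gaussian natural exponential families with quadratic variance function $V(y)=\nu_0+\nu_1y+\nu_2y^2$), where $Y_i$ has mean $\theta_i$, known convolution parameter $\tau_i>0$ and variance $V(\theta_i)/\tau_i$, and assume the conditions listed for that family (with $O(p)$ as $p\to\infty$): - Binomial: $Y_i\sim \mathrm{Bin}(n_i,p_i)/n_i$ with integers $n_i$ and $p_i\in[0,1]$; $\tau_i=n_i$, $\theta_i=p_i$, $(\nu_0,\nu_1,\nu_2)=(0,1,-1)$. Condition: $n_i\ge 2$ for all $i$. - Poisson: $Y_i\sim \mathrm{Poi}(\tau_i\theta_i)/\tau_i$ with $\tau_i,\theta_i>0$; $(\nu_0,\nu_1,\nu_2)=(0,1,0)$. Conditions: $\inf_i\tau_i>0$, $\inf_i\tau_i\theta_i>0$ and $\sum_{i=1}^p\theta_i^3=O(p)$. - Negative binomial: $Y_i\sim \mathrm{NBin}(n_i,p_i)/n_i$ with $n_i>0$, $p_i\in(0,1)$, where $\mathrm{NBin}(n,q)$ has mass $\frac{n(n+1)\cdots(n+k-1)}{k!}q^k(1-q)^n$ at $k=0,1,2,\dots$;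 $\tau_i=n_i$, $\theta_i=\frac{p_i}{1-p_i}$, $(\nu_0,\nu_1,\nu_2)=(0,1,1)$. Conditions: $\inf_i n_ip_i>0$ and $\sum_{i=1}^p\bigl(\frac{p_i}{1-p_i}\bigr)^4=O(p)$. - Gamma: $Y_i\sim\Gamma(\tau_i\alpha,\lambda_i)/\tau_i$ (shape $\tau_i\alpha$, scale $\lambda_i$) with a constant $\alpha>0$ and $\tau_i,\lambda_i>0$; $\theta_i=\alpha\lambda_i$, $(\nu_0,\nu_1,\nu_2)=(0,0,1/\alpha)$. Conditions: $\inf_i\tau_i>0$ and $\sum_{i=1}^p\lambda_i^4=O(p)$. - Generalized hyperbolic secant: $Y_i\sim \mathrm{GHS}(\tau_i\alpha,\lambda_i)/\tau_i$ with a constant $\alpha>0$, $\tau_i>0$ and $\lambda_i\in\mathbb R$, where $\mathrm{GHS}(r,\lambda)$ has density $(1+\lambda^2)^{-r/2}e^{x\arctan\lambda}\,\frac{2^{r-2}}{\pi\Gamma(r)}\bigl|\Gamma\bigl(\tfrac{r+ix}{2}\bigr)\bigr|^2$ on $\mathbb R$; $\theta_i=\alpha\lambda_i$, $(\nu_0,\nu_1,\nu_2)=(\alpha,0,1/\alpha)$.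 Conditions: $\inf_i\tau_i>0$ and $\sum_{i=1}^p\lambda_i^4=O(p)$. For $p\ge1$ and $\gamma\ge0$ put $\bar Y=\frac1p\sum_{i=1}^pY_i$, $\hat\theta_i^{\gamma,\bar Y}=\frac{\tau_i}{\tau_i+\gamma}Y_i+\frac{\gamma}{\tau_i+\gamma}\bar Y$, $l_p(\theta,\hat\theta^{\gamma,\bar Y})=\frac1p\sum_{i=1}^p(\hat\theta_i^{\gamma,\bar Y}-\theta_i)^2$ and $$\mathrm{URE}^{PG}(\gamma)=\frac1p\sum_{i=1}^p\left[\frac{\gamma^2}{(\tau_i+\gamma)^2}(Y_i-\bar Y)^2+\left(1-2\Bigl(1-\frac1p\Bigr)\frac{\gamma}{\tau_i+\gamma}\right)\frac{V(Y_i)}{\tau_i+\nu_2}\right].$$ Then $$\sup_{0\le\gamma<\infty}\bigl|\mathrm{URE}^{PG}(\gamma)-l_p(\theta,\hat\theta^{\gamma,\bar Y})\bigr|\to0\quad\text{in }L^1\text{ and in probability, as }p\to\infty.$$ -/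

import Mathlib

open MeasureTheory ProbabilityTheory Filter Asymptotics
open scoped Topology

namespace NEFQVF

/-- The five non-Gaussian natural exponential families with quadratic variance function.
For the gamma and the generalized hyperbolic secant (GHS) family, `α` is a fixed known constant. -/
inductive Family where
  | binomial : Family
  | poisson : Family
  | negBinomial : Family
  | gamma (α : ℝ) : Family
  | ghs (α : ℝ) : Family

/-- The negative binomial distribution on `ℕ` with (not necessarily integral) size `n` and
parameter `q`: the mass at `k` is `n (n + 1) ⋯ (n + k - 1) / k! * q ^ k * (1 - q) ^ n`. Its mean is
`n * q / (1 - q)`. -/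
noncomputable def negBinomialMeasure (n q : ℝ) : Measure ℕ :=
  Measure.sum fun k : ℕ =>
    ENNReal.ofReal ((ascPochhammer ℝ k).eval n / (k.factorial : ℝ) * q ^ k * (1 - q) ^ n) •
      Measure.dirac k

/-- The density of the generalized hyperbolic secant distribution `GHS(r, l)`, which has mean
`r * l` and variance `r * (1 + l ^ 2)`:
`(1 + l²)^(-r/2) * exp(x arctan l) * 2^(r-2) * |Γ((r + i x)/2)|² / (π Γ(r))`.
For `r = 1`, `l = 0` this is the hyperbolic secant density `1 / (2 cosh (π x / 2))`. -/
noncomputable def ghsPDFReal (r l x : ℝ) : ℝ :=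
  (1 + l ^ 2) ^ (-(r / 2)) * Real.exp (x * Real.arctan l) *
    ((2 : ℝ) ^ (r - 2) * ‖Complex.Gamma (((r : ℂ) + (x : ℂ) * Complex.I) / 2)‖ ^ 2 /
      (Real.pi * Real.Gamma r))

/-- The generalized hyperbolic secant distribution `GHS(r, l)`. -/
noncomputable def ghsMeasure (r l : ℝ) : Measure ℝ :=
  volume.withDensity fun x => ENNReal.ofReal (ghsPDFReal r l x)

namespace Family

/-- The coefficient `ν₀` of the variance function. -/
noncomputable def nu0 : Family → ℝ
  | binomial => 0
  | poisson => 0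
  | negBinomial => 0
  | gamma _ => 0
  | ghs α => α

/-- The coefficient `ν₁` of the variance function. -/
noncomputable def nu1 : Family → ℝ
  | binomial => 1
  | poisson => 1
  | negBinomial => 1
  | gamma _ => 0
  | ghs _ => 0

/-- The coefficient `ν₂` of the variance function. -/
noncomputable def nu2 : Family → ℝ
  | binomial => -1
  | poisson => 0
  | negBinomial => 1
  | gamma α => 1 / α
  | ghs α => 1 / α

/-- The quadratic variance function `V(y) = ν₀ + ν₁ y + ν₂ y²`. -/
noncomputable def V (F : Family) (y : ℝ) : ℝ :=
  F.nu0 + F.nu1 * y + F.nu2 * y ^ 2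

/-- The mean `θ` of an observation as a function of the usual parameter `ξ` of each family:
the success probability for the binomial, `θ` itself for the Poisson, `q` with `θ = q / (1 - q)` for
the negative binomial, and the scale `l` with `θ = α l` for the gamma and GHS families. -/
noncomputable def mean : Family → ℝ → ℝ
  | binomial, ξ => ξ
  | poisson, ξ => ξ
  | negBinomial, ξ => ξ / (1 - ξ)
  | gamma α, ξ => α * ξ
  | ghs α, ξ => α * ξ

/-- The parameters `ξ` and convolution parameters `τ` for which the distribution is defined. -/
def Admissible : Family → ℝ → ℝ → Prop
  | binomial, ξ, τ => (∃ n : ℕ, 1 ≤ n ∧ τ = n) ∧ 0 ≤ ξ ∧ ξ ≤ 1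
  | poisson, ξ, τ => 0 < τ ∧ 0 < ξ
  | negBinomial, ξ, τ => 0 < τ ∧ 0 < ξ ∧ ξ < 1
  | gamma α, ξ, τ => 0 < α ∧ 0 < τ ∧ 0 < ξ
  | ghs α, _, τ => 0 < α ∧ 0 < τ

/-- The law of the unnormalized observation `τ Y`: `Bin(τ, ξ)`, `Poi(τ ξ)`, `NBin(τ, ξ)`,
`Γ(τ α, ξ)` (shape `τ α`, scale `ξ`; Mathlib's gamma law takes the rate `ξ⁻¹`), `GHS(τ α, ξ)`. -/
noncomputable def totalLaw : Family → ℝ → ℝ → Measure ℝ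
  | binomial, ξ, τ =>
      (ProbabilityTheory.binomial ⌊τ⌋₊ (Set.projIcc 0 1 zero_le_one ξ)).map (Nat.cast : ℕ → ℝ)
  | poisson, ξ, τ => (poissonMeasure (τ * ξ).toNNReal).map (Nat.cast : ℕ → ℝ)
  | negBinomial, ξ, τ => (negBinomialMeasure τ ξ).map (Nat.cast : ℕ → ℝ)
  | gamma α, ξ, τ => gammaMeasure (τ * α) ξ⁻¹
  | ghs α, ξ, τ => ghsMeasure (τ * α) ξ

/-- The law `NEF-QVF[θ, V(θ)/τ]` of an observation `Y`, where `θ = F.mean ξ`. -/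
noncomputable def law (F : Family) (ξ τ : ℝ) : Measure ℝ :=
  (F.totalLaw ξ τ).map fun x => x / τ

/-- The conditions on the parameter sequences that are imposed in each family. -/
def Conditions : Family → (ℕ → ℝ) → (ℕ → ℝ) → Prop
  | binomial, _, τ => ∀ i, 2 ≤ τ i
  | poisson, ξ, τ =>
      (∃ c > 0, ∀ i, c ≤ τ i) ∧ (∃ c > 0, ∀ i, c ≤ τ i * ξ i) ∧
        (fun p : ℕ => ∑ i ∈ Finset.range p, ξ i ^ 3) =O[atTop] (fun p : ℕ => (p : ℝ))
  | negBinomial, ξ, τ =>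
      (∃ c > 0, ∀ i, c ≤ τ i * ξ i) ∧
        (fun p : ℕ => ∑ i ∈ Finset.range p, (ξ i / (1 - ξ i)) ^ 4) =O[atTop]
          (fun p : ℕ => (p : ℝ))
  | gamma _, ξ, τ =>
      (∃ c > 0, ∀ i, c ≤ τ i) ∧
        (fun p : ℕ => ∑ i ∈ Finset.range p, ξ i ^ 4) =O[atTop] (fun p : ℕ => (p : ℝ))
  | ghs _, ξ, τ =>
      (∃ c > 0, ∀ i, c ≤ τ i) ∧
        (fun p : ℕ => ∑ i ∈ Finset.range p, ξ i ^ 4) =O[atTop] (fun p : ℕ => (p : ℝ))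

end Family

/-- The grand mean of the first `p` observations. -/
noncomputable def grandMean (p : ℕ) (y : ℕ → ℝ) : ℝ :=
  1 / (p : ℝ) * ∑ i ∈ Finset.range p, y i

/-- The parametric grand-mean shrinkage estimator of the `i`-th mean,
based on the first `p` observations. -/
noncomputable def shrink (p : ℕ) (τ y : ℕ → ℝ) (γ : ℝ) (i : ℕ) : ℝ :=
  τ i / (τ i + γ) * y i + γ / (τ i + γ) * grandMean p y

/-- The average squared-error loss of an estimate `t` of the first `p` entries of `θ`. -/
noncomputable def loss (p : ℕ) (θ t : ℕ → ℝ) : ℝ :=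
  1 / (p : ℝ) * ∑ i ∈ Finset.range p, (t i - θ i) ^ 2

/-- The unbiased risk estimate `URE^PG(γ)` of the grand-mean shrinkage estimator. -/
noncomputable def ure (F : Family) (p : ℕ) (τ y : ℕ → ℝ) (γ : ℝ) : ℝ :=
  1 / (p : ℝ) * ∑ i ∈ Finset.range p,
    (γ ^ 2 / (τ i + γ) ^ 2 * (y i - grandMean p y) ^ 2 +
      (1 - 2 * (1 - 1 / (p : ℝ)) * (γ / (τ i + γ))) * (F.V (y i) / (τ i + F.nu2)))

/-- `|URE^PG(γ) - l_p(θ, θ̂^{γ, Ȳ})|` at the data `y`. -/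
noncomputable def discrepancy (F : Family) (p : ℕ) (θ τ y : ℕ → ℝ) (γ : ℝ) : ℝ :=
  |ure F p τ y γ - loss p θ (shrink p τ y γ)|

/-- The supremum of the discrepancy over `0 ≤ γ < ∞`. -/
noncomputable def supDiscrepancy (F : Family) (p : ℕ) (θ τ y : ℕ → ℝ) : ℝ :=
  ⨆ γ : Set.Ici (0 : ℝ), discrepancy F p θ τ y γ

end NEFQVF

namespace NEFQVF

/-- Abel summation: antitone weights in `[0, 1]` do not increase the maximal partial sum. -/
theorem abs_sum_mul_le_of_antitone {n : ℕ} {b z : ℕ → ℝ} {M : ℝ} (hM : 0 ≤ M)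
    (hb0 : ∀ i < n, 0 ≤ b i) (hb1 : ∀ i < n, b i ≤ 1)
    (hb : ∀ i, i + 1 < n → b (i + 1) ≤ b i)
    (hz : ∀ j ≤ n, |∑ i ∈ Finset.range j, z i| ≤ M) :
    |∑ i ∈ Finset.range n, b i * z i| ≤ M := by
  rcases n with _ | n
  · simpa using hM
  have key : ∀ k ≤ n, |∑ i ∈ Finset.range (k + 1), b i * z i -
      b k * ∑ i ∈ Finset.range (k + 1), z i| ≤ (b 0 - b k) * M := by
    intro k
    induction k with
    | zero => intro _; simp
    | succ k ih =>
      intro hk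
      have h1 := ih (by omega)
      have h2 := hz (k + 1) (by omega)
      have h3 := hb k (by omega)
      rw [Finset.sum_range_succ _ (k + 1), Finset.sum_range_succ z (k + 1)]
      set S := ∑ i ∈ Finset.range (k + 1), z i
      set T := ∑ i ∈ Finset.range (k + 1), b i * z i
      have e : T + b (k + 1) * z (k + 1) - b (k + 1) * (S + z (k + 1)) =
          (T - b k * S) + (b k - b (k + 1)) * S := by ring
      rw [e]
      refine (abs_add_le _ _).trans ?_
      rw [abs_mul, abs_of_nonneg (sub_nonneg.2 h3)]
      nlinarith [mul_le_mul_of_nonneg_left h2 (sub_nonneg.2 h3)]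
  have h1 := key n le_rfl
  have h2 := hz (n + 1) le_rfl
  set S := ∑ i ∈ Finset.range (n + 1), z i
  set T := ∑ i ∈ Finset.range (n + 1), b i * z i
  have h3 : |T| ≤ |T - b n * S| + |b n * S| := by
    have := abs_add_le (T - b n * S) (b n * S)
    simpa using this
  rw [abs_mul, abs_of_nonneg (hb0 n (by omega))] at h3
  nlinarith [mul_le_mul_of_nonneg_left h2 (hb0 n (by omega)), hb1 0 (by omega)]

/-- An enumeration of `{0, …, p - 1}` along which `τ` is monotone. -/
theorem exists_monotone_enumeration (τ : ℕ → ℝ) (p : ℕ) :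
    ∃ e : ℕ → ℕ, Set.InjOn e (Finset.range p) ∧ (Finset.range p).image e = Finset.range p ∧
      ∀ i j, i ≤ j → j < p → τ (e i) ≤ τ (e j) := by
  set f : Fin p → ℝ := fun i => τ i
  set σ := Tuple.sort f
  have hmono : Monotone (f ∘ σ) := Tuple.monotone_sort f
  set e : ℕ → ℕ := fun i => if h : i < p then (σ ⟨i, h⟩ : ℕ) else 0
  have he : ∀ i (h : i < p), e i = (σ ⟨i, h⟩ : ℕ) := fun i h => by simp [e, h]
  have hinj : Set.InjOn e (Finset.range p) := by
    intro i hi j hj hij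
    have hi' : i < p := by simpa using hi
    have hj' : j < p := by simpa using hj
    rw [he i hi', he j hj'] at hij
    simpa using σ.injective (Fin.ext hij)
  refine ⟨e, hinj, ?_, ?_⟩
  · refine Finset.eq_of_subset_of_card_le ?_ ?_
    · intro x hx
      obtain ⟨i, hi, rfl⟩ := Finset.mem_image.1 hx
      have hi' : i < p := by simpa using hi
      rw [he i hi']
      simp
    · rw [Finset.card_image_of_injOn hinj]
  · intro i j hij hj
    rw [he i (hij.trans_lt hj), he j hj]
    exact hmono (show (⟨i, hij.trans_lt hj⟩ : Fin p) ≤ ⟨j, hj⟩ from hij)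

/-- Partial sums are controlled by the partial sums at multiples of the block size `m`. -/
theorem sq_partial_sum_le_blocks {p m : ℕ} (hm : 0 < m) (w : ℕ → ℝ) {j : ℕ} (hj : j ≤ p) :
    (∑ i ∈ Finset.range j, w i) ^ 2 ≤
      2 * ∑ k ∈ Finset.range (p / m + 1), (∑ i ∈ Finset.range (k * m), w i) ^ 2 +
        2 * m * ∑ i ∈ Finset.range p, w i ^ 2 := by
  set k := j / m
  have hkm : k * m ≤ j := Nat.div_mul_le_self j m
  have hjk : j - j / m * m ≤ m := by
    have := Nat.div_add_mod' j m
    have := Nat.mod_lt j hm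
    omega
  have h1 : (∑ i ∈ Finset.range (k * m), w i) ^ 2 ≤
      ∑ k ∈ Finset.range (p / m + 1), (∑ i ∈ Finset.range (k * m), w i) ^ 2 :=
    Finset.single_le_sum (f := fun k => (∑ i ∈ Finset.range (k * m), w i) ^ 2)
      (fun _ _ => sq_nonneg _)
      (Finset.mem_range.2 (Nat.lt_succ_of_le (Nat.div_le_div_right hj)))
  have h2 : (∑ i ∈ Finset.Ico (k * m) j, w i) ^ 2 ≤ m * ∑ i ∈ Finset.range p, w i ^ 2 := by
    refine (sq_sum_le_card_mul_sum_sq (s := Finset.Ico (k * m) j) (f := w)).trans ?_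
    rw [Nat.card_Ico]
    have hs : ∑ i ∈ Finset.Ico (k * m) j, w i ^ 2 ≤ ∑ i ∈ Finset.range p, w i ^ 2 :=
      Finset.sum_le_sum_of_subset_of_nonneg
        (fun i hi => Finset.mem_range.2 ((Finset.mem_Ico.1 hi).2.trans_le hj))
        (fun _ _ _ => sq_nonneg _)
    exact mul_le_mul (by exact_mod_cast hjk) hs (Finset.sum_nonneg fun _ _ => sq_nonneg _)
      (by positivity)
  rw [← Finset.sum_range_add_sum_Ico w hkm]
  nlinarith [sq_nonneg (∑ i ∈ Finset.range (k * m), w i - ∑ i ∈ Finset.Ico (k * m) j, w i)]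

/-- The weighted sums with weights `γ / (τ i + γ)` are bounded, uniformly in `γ`, by few unweighted
sums. -/
theorem exists_chain_bound (τ : ℕ → ℝ) (hτ : ∀ i, 0 < τ i) {p m : ℕ} (hm : 0 < m) :
    ∃ s : ℕ → Finset ℕ, (∀ k < p / m + 1, s k ⊆ Finset.range p) ∧
      ∀ (z : ℕ → ℝ) (γ : ℝ), 0 ≤ γ →
        (∑ i ∈ Finset.range p, γ / (τ i + γ) * z i) ^ 2 ≤
          2 * ∑ k ∈ Finset.range (p / m + 1), (∑ i ∈ s k, z i) ^ 2 +
            2 * m * ∑ i ∈ Finset.range p, z i ^ 2 := by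
  obtain ⟨e, hinj, himg, hmono⟩ := exists_monotone_enumeration τ p
  have hsub : ∀ k < p / m + 1, k * m ≤ p := fun k hk =>
    (Nat.mul_le_mul_right m (Nat.lt_succ_iff.1 hk)).trans (Nat.div_mul_le_self p m)
  have hsum : ∀ (f : ℕ → ℝ) (j : ℕ), j ≤ p →
      ∑ i ∈ (Finset.range j).image e, f i = ∑ i ∈ Finset.range j, f (e i) := by
    intro f j hj
    refine Finset.sum_image (hinj.mono ?_)
    intro i hi
    simp only [Finset.coe_range, Set.mem_Iio] at hi ⊢
    omega
  refine ⟨fun k => (Finset.range (k * m)).image e, ?_, ?_⟩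
  · intro k hk
    rw [← himg]
    exact Finset.image_subset_image (Finset.range_subset_range.2 (hsub k hk))
  intro z γ hγ
  have h0 : ∀ f : ℕ → ℝ, ∑ i ∈ Finset.range p, f i = ∑ i ∈ Finset.range p, f (e i) := by
    intro f
    rw [← hsum f p le_rfl, himg]
  set w : ℕ → ℝ := fun i => z (e i)
  set R : ℝ := 2 * ∑ k ∈ Finset.range (p / m + 1), (∑ i ∈ Finset.range (k * m), w i) ^ 2 +
    2 * m * ∑ i ∈ Finset.range p, w i ^ 2
  have hR : 2 * ∑ k ∈ Finset.range (p / m + 1),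
      (∑ i ∈ (Finset.range (k * m)).image e, z i) ^ 2 +
        2 * m * ∑ i ∈ Finset.range p, z i ^ 2 = R := by
    simp only [R]
    rw [h0 (fun i => z i ^ 2)]
    congr 2
    refine Finset.sum_congr rfl fun k hk => ?_
    rw [hsum z _ (hsub k (Finset.mem_range.1 hk))]
  rw [hR, h0]
  have hR0 : 0 ≤ R := by positivity
  have hpos : ∀ i, 0 < τ i + γ := fun i => by have := hτ i; linarith
  rw [← sq_abs, ← Real.sq_sqrt hR0]
  refine pow_le_pow_left₀ (abs_nonneg _) ?_ 2
  refine abs_sum_mul_le_of_antitone (b := fun i => γ / (τ (e i) + γ)) (Real.sqrt_nonneg _)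
    (fun i _ => div_nonneg hγ (hpos _).le)
    (fun i _ => (div_le_one (hpos _)).2 (by have := hτ (e i); linarith)) ?_ ?_
  · intro i hi
    have := hmono i (i + 1) (by omega) hi
    exact div_le_div_of_nonneg_left hγ (hpos _) (by linarith)
  · intro j hj
    refine Real.le_sqrt_of_sq_le ?_
    rw [sq_abs]
    exact sq_partial_sum_le_blocks hm w hj

/-- `Y` has mean `θ`, variance `v`, and `A` bounds its fourth central moment, `θ² v` and `θ²`. -/
structure FourthMomentBounds {Ω : Type*} [MeasurableSpace Ω] (P : Measure Ω) (Y : Ω → ℝ)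
    (θ v A : ℝ) : Prop where
  aemeasurable : AEMeasurable Y P
  integrable_fourth : Integrable (fun ω => (Y ω - θ) ^ 4) P
  integral_eq : ∫ ω, Y ω ∂P = θ
  integral_sq : ∫ ω, (Y ω - θ) ^ 2 ∂P = v
  integral_fourth_le : ∫ ω, (Y ω - θ) ^ 4 ∂P ≤ A
  sq_mul_le : θ ^ 2 * v ≤ A
  sq_le : θ ^ 2 ≤ A

theorem FourthMomentBounds.of_hasLaw {Ω : Type*} [MeasurableSpace Ω] {P : Measure Ω} {Y : Ω → ℝ}
    {μ : Measure ℝ} {θ v A : ℝ} (hY : HasLaw Y μ P)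
    (h : FourthMomentBounds μ (fun x => x) θ v A) : FourthMomentBounds P Y θ v A where
  aemeasurable := hY.aemeasurable
  integrable_fourth := by
    have := h.integrable_fourth
    rw [← hY.map_eq] at this
    exact this.comp_aemeasurable hY.aemeasurable
  integral_eq := by rw [← h.integral_eq]; exact hY.integral_eq
  integral_sq := by
    rw [← h.integral_sq]
    exact hY.integral_comp (f := fun x => (x - θ) ^ 2) (by fun_prop)
  integral_fourth_le := by
    refine le_trans (le_of_eq ?_) h.integral_fourth_le
    exact hY.integral_comp (f := fun x => (x - θ) ^ 4) (by fun_prop)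
  sq_mul_le := h.sq_mul_le
  sq_le := h.sq_le

/-- `X` is square integrable and centred, with second moment at most `e`. -/
structure CenteredBound {Ω : Type*} [MeasurableSpace Ω] (P : Measure Ω) (X : Ω → ℝ)
    (e : ℝ) : Prop where
  memLp : MemLp X 2 P
  integral_eq : ∫ ω, X ω ∂P = 0
  integral_sq_le : ∫ ω, X ω ^ 2 ∂P ≤ e

section single

variable {Ω : Type*} [MeasurableSpace Ω] {P : Measure Ω} {Y : Ω → ℝ} {θ v A : ℝ}

namespace FourthMomentBounds

theorem memLp_sq (h : FourthMomentBounds P Y θ v A) : MemLp (fun ω => (Y ω - θ) ^ 2) 2 P := by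
  have hm : AEStronglyMeasurable (fun ω => (Y ω - θ) ^ 2) P :=
    ((h.aemeasurable.sub_const θ).pow_const 2).aestronglyMeasurable
  rw [memLp_two_iff_integrable_sq hm]
  refine h.integrable_fourth.congr (ae_of_all _ fun ω => ?_)
  ring

theorem variance_nonneg (h : FourthMomentBounds P Y θ v A) : 0 ≤ v := by
  rw [← h.integral_sq]
  exact integral_nonneg fun ω => sq_nonneg _

theorem nonneg (h : FourthMomentBounds P Y θ v A) : 0 ≤ A := (sq_nonneg θ).trans h.sq_le

variable [IsProbabilityMeasure P]

theorem memLp (h : FourthMomentBounds P Y θ v A) : MemLp (fun ω => Y ω - θ) 2 P := by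
  rw [memLp_two_iff_integrable_sq (h.aemeasurable.sub_const θ).aestronglyMeasurable]
  exact h.memLp_sq.integrable one_le_two

theorem integral_sub (h : FourthMomentBounds P Y θ v A) : ∫ ω, (Y ω - θ) ∂P = 0 := by
  have hY : Integrable Y P := by
    have := (h.memLp.integrable one_le_two).add (integrable_const θ)
    refine this.congr (ae_of_all _ fun ω => ?_)
    simp
  rw [MeasureTheory.integral_sub hY (integrable_const θ), h.integral_eq]
  simp

theorem variance_le (h : FourthMomentBounds P Y θ v A) : v ≤ 1 + A := by
  rw [← h.integral_sq]
  have h1 : ∫ ω, (Y ω - θ) ^ 2 ∂P ≤ ∫ ω, (1 + (Y ω - θ) ^ 4) ∂P := by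
    refine integral_mono (h.memLp_sq.integrable one_le_two)
      ((integrable_const 1).add h.integrable_fourth) fun ω => ?_
    change (Y ω - θ) ^ 2 ≤ 1 + (Y ω - θ) ^ 4
    nlinarith [sq_nonneg ((Y ω - θ) ^ 2 - 1), sq_nonneg ((Y ω - θ) ^ 2)]
  rw [integral_add (integrable_const 1) h.integrable_fourth] at h1
  have h2 := h.integral_fourth_le
  simp only [integral_const, probReal_univ, smul_eq_mul, mul_one] at h1
  linarith

theorem integral_sq_sub_sq_le (h : FourthMomentBounds P Y θ v A) :
    ∫ ω, ((Y ω - θ) ^ 2 - v) ^ 2 ∂P ≤ A := by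
  have hi := h.memLp_sq.integrable one_le_two
  have e : (fun ω => ((Y ω - θ) ^ 2 - v) ^ 2) =
      fun ω => ((Y ω - θ) ^ 4 - 2 * v * (Y ω - θ) ^ 2) + v ^ 2 := by
    funext ω
    ring
  have hi' : Integrable (fun ω => 2 * v * (Y ω - θ) ^ 2) P := hi.const_mul _
  have hi4 : Integrable (fun ω => (Y ω - θ) ^ 4 - 2 * v * (Y ω - θ) ^ 2) P :=
    h.integrable_fourth.sub hi'
  rw [e, integral_add hi4 (integrable_const _),
    MeasureTheory.integral_sub h.integrable_fourth hi', integral_const_mul, h.integral_sq]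
  have := h.integral_fourth_le
  simp only [integral_const, probReal_univ, smul_eq_mul, one_mul]
  nlinarith [sq_nonneg v]

/-- Second moments of the centred quadratic polynomials in `Y`. -/
theorem centeredBound (h : FourthMomentBounds P Y θ v A) (a b : ℝ) :
    CenteredBound P (fun ω => a * (Y ω - θ) + b * ((Y ω - θ) ^ 2 - v))
      (2 * a ^ 2 * v + 2 * b ^ 2 * A) := by
  have hq : MemLp (fun ω => (Y ω - θ) ^ 2 - v) 2 P := h.memLp_sq.sub (memLp_const v)
  have m1 : MemLp (fun ω => a * (Y ω - θ)) 2 P := h.memLp.const_mul a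
  have m2 : MemLp (fun ω => b * ((Y ω - θ) ^ 2 - v)) 2 P := hq.const_mul b
  have m3 : MemLp (fun ω => a * (Y ω - θ) + b * ((Y ω - θ) ^ 2 - v)) 2 P := m1.add m2
  refine ⟨m3, ?_, ?_⟩
  · rw [integral_add (m1.integrable one_le_two) (m2.integrable one_le_two),
      integral_const_mul, integral_const_mul, h.integral_sub,
      MeasureTheory.integral_sub (h.memLp_sq.integrable one_le_two) (integrable_const v),
      h.integral_sq]
    simp
  · have i1 : Integrable (fun ω => 2 * a ^ 2 * (Y ω - θ) ^ 2) P := h.memLp.integrable_sq.const_mul _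
    have i2 : Integrable (fun ω => 2 * b ^ 2 * ((Y ω - θ) ^ 2 - v) ^ 2) P :=
      hq.integrable_sq.const_mul _
    have h1 := integral_mono m3.integrable_sq (i1.add i2) (fun ω => by
      change (a * (Y ω - θ) + b * ((Y ω - θ) ^ 2 - v)) ^ 2 ≤
        2 * a ^ 2 * (Y ω - θ) ^ 2 + 2 * b ^ 2 * ((Y ω - θ) ^ 2 - v) ^ 2
      nlinarith [sq_nonneg (a * (Y ω - θ) - b * ((Y ω - θ) ^ 2 - v))])
    refine h1.trans ?_
    simp only [Pi.add_apply]
    rw [integral_add i1 i2, integral_const_mul, integral_const_mul, h.integral_sq]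
    have := mul_le_mul_of_nonneg_left h.integral_sq_sub_sq_le (by positivity : 0 ≤ 2 * b ^ 2)
    linarith

theorem integral_sq_self_le (h : FourthMomentBounds P Y θ v A) :
    Integrable (fun ω => Y ω ^ 2) P ∧ ∫ ω, Y ω ^ 2 ∂P ≤ 4 * (1 + A) := by
  have hY : MemLp Y 2 P := by
    have := h.memLp.add (memLp_const θ)
    refine this.ae_eq (ae_of_all _ fun ω => ?_)
    simp
  refine ⟨hY.integrable_sq, ?_⟩
  have i1 : Integrable (fun ω => 2 * (Y ω - θ) ^ 2) P := h.memLp.integrable_sq.const_mul _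
  have h1 := integral_mono hY.integrable_sq (i1.add (integrable_const (2 * θ ^ 2))) (fun ω => by
    change Y ω ^ 2 ≤ 2 * (Y ω - θ) ^ 2 + 2 * θ ^ 2
    nlinarith [sq_nonneg (Y ω - θ - θ)])
  refine h1.trans ?_
  simp only [Pi.add_apply]
  rw [integral_add i1 (integrable_const _), integral_const_mul, h.integral_sq]
  simp only [integral_const, probReal_univ, smul_eq_mul, one_mul]
  have := h.variance_le
  have := h.sq_le
  linarith

end FourthMomentBounds

variable [IsProbabilityMeasure P]

/-- The unbiased estimate `V(y) / (τ + ν₂)` of the variance. -/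
noncomputable def varEst (F : Family) (t y : ℝ) : ℝ := F.V y / (t + F.nu2)

theorem varEst_eq (F : Family) {t : ℝ} (ht : 0 < t) (hd : 0 < t + F.nu2) (y θ : ℝ) :
    varEst F t y = F.V θ / t + ((F.nu1 + 2 * F.nu2 * θ) / (t + F.nu2) * (y - θ) +
      F.nu2 / (t + F.nu2) * ((y - θ) ^ 2 - F.V θ / t)) := by
  unfold varEst Family.V
  have h1 := hd.ne'
  have h2 := ht.ne'
  field_simp
  ring

/-- All moments of the observation that enter the comparison of the risk estimate with the loss are
bounded by a multiple of `1 + A`. -/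
theorem FourthMomentBounds.estimates {F : Family} {t c : ℝ}
    (h : FourthMomentBounds P Y θ (F.V θ / t) A) (ht : 0 < t) (hd : 0 < t + F.nu2) (hc : 1 ≤ c)
    (hc1 : |F.nu1 / (t + F.nu2)| ≤ c) (hc2 : |F.nu2 / (t + F.nu2)| ≤ c) :
    CenteredBound P (fun ω => varEst F t (Y ω) - (Y ω - θ) ^ 2) (60 * c ^ 2 * (1 + A)) ∧
    CenteredBound P (fun ω => (Y ω - θ) * Y ω - varEst F t (Y ω)) (60 * c ^ 2 * (1 + A)) ∧
    CenteredBound P (fun ω => Y ω - θ) (60 * c ^ 2 * (1 + A)) ∧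
    (Integrable (fun ω => |varEst F t (Y ω)|) P ∧
      ∫ ω, |varEst F t (Y ω)| ∂P ≤ 60 * c ^ 2 * (1 + A)) ∧
    (Integrable (fun ω => Y ω ^ 2) P ∧ ∫ ω, Y ω ^ 2 ∂P ≤ 60 * c ^ 2 * (1 + A)) := by
  set v := F.V θ / t with hv
  set a := (F.nu1 + 2 * F.nu2 * θ) / (t + F.nu2) with ha
  set b := F.nu2 / (t + F.nu2) with hb
  have hv0 := h.variance_nonneg
  have hv1 := h.variance_le
  have hA := h.nonneg
  have hm := h.sq_mul_le
  have hcc : 1 ≤ c ^ 2 := one_le_pow₀ hc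
  have hb2 : b ^ 2 ≤ c ^ 2 := sq_le_sq' (abs_le.1 hc2).1 (abs_le.1 hc2).2
  have hn2 : (F.nu1 / (t + F.nu2)) ^ 2 ≤ c ^ 2 := sq_le_sq' (abs_le.1 hc1).1 (abs_le.1 hc1).2
  have ha2 : a ^ 2 ≤ 2 * c ^ 2 + 8 * c ^ 2 * θ ^ 2 := by
    have e : a = F.nu1 / (t + F.nu2) + 2 * b * θ := by rw [ha, hb]; ring
    rw [e]
    nlinarith [sq_nonneg (F.nu1 / (t + F.nu2) - 2 * b * θ),
      mul_le_mul_of_nonneg_right hb2 (sq_nonneg θ)]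
  have hav : a ^ 2 * v ≤ 2 * c ^ 2 * v + 8 * c ^ 2 * A := by
    have h1 := mul_le_mul_of_nonneg_right ha2 hv0
    have h2 := mul_le_mul_of_nonneg_left hm (by positivity : 0 ≤ 8 * c ^ 2)
    linarith
  have hcv : c ^ 2 * v ≤ c ^ 2 * (1 + A) := mul_le_mul_of_nonneg_left hv1 (by positivity)
  have hcA : 1 + A ≤ c ^ 2 * (1 + A) := by nlinarith
  have hbA : b ^ 2 * A ≤ c ^ 2 * A := mul_le_mul_of_nonneg_right hb2 hA
  have hbb : (1 - b) ^ 2 ≤ 4 * c ^ 2 := by nlinarith [sq_nonneg (1 + b)]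
  have hbbA : (1 - b) ^ 2 * A ≤ 4 * c ^ 2 * A := mul_le_mul_of_nonneg_right hbb hA
  have eW : ∀ ω, varEst F t (Y ω) = v + (a * (Y ω - θ) + b * ((Y ω - θ) ^ 2 - v)) :=
    fun ω => varEst_eq F ht hd (Y ω) θ
  have mono : ∀ {X : Ω → ℝ} {e e' : ℝ}, CenteredBound P X e → e ≤ e' → CenteredBound P X e' :=
    fun hX he => ⟨hX.memLp, hX.integral_eq, hX.integral_sq_le.trans he⟩
  have hc0 : 0 ≤ c ^ 2 := sq_nonneg c
  have hcA0 : 0 ≤ c ^ 2 * A := by positivity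
  refine ⟨?_, ?_, ?_, ?_, ?_⟩
  · have e : (fun ω => varEst F t (Y ω) - (Y ω - θ) ^ 2) =
        fun ω => a * (Y ω - θ) + (b - 1) * ((Y ω - θ) ^ 2 - v) := by
      funext ω
      rw [eW]
      ring
    rw [e]
    refine mono (h.centeredBound a (b - 1)) ?_
    have e2 : (b - 1) ^ 2 = (1 - b) ^ 2 := by ring
    rw [e2]
    linarith
  · have e : (fun ω => (Y ω - θ) * Y ω - varEst F t (Y ω)) =
        fun ω => (θ - a) * (Y ω - θ) + (1 - b) * ((Y ω - θ) ^ 2 - v) := by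
      funext ω
      rw [eW]
      ring
    rw [e]
    refine mono (h.centeredBound (θ - a) (1 - b)) ?_
    have h1 : (θ - a) ^ 2 * v ≤ 2 * (θ ^ 2 * v) + 2 * (a ^ 2 * v) := by
      nlinarith [mul_nonneg (sq_nonneg (θ + a)) hv0]
    linarith
  · have := h.centeredBound 1 0
    simp only [one_mul, zero_mul, add_zero] at this
    refine mono this ?_
    linarith
  · have hC := h.centeredBound a b
    set X := fun ω => a * (Y ω - θ) + b * ((Y ω - θ) ^ 2 - v) with hX
    have e : (fun ω => |varEst F t (Y ω)|) = fun ω => |v + X ω| := by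
      funext ω
      rw [eW]
    rw [e]
    have hi : Integrable (fun ω => |v + X ω|) P :=
      ((integrable_const v).add (hC.memLp.integrable one_le_two)).abs
    refine ⟨hi, ?_⟩
    have h1 := integral_mono hi ((integrable_const (v + 1)).add hC.memLp.integrable_sq)
      (fun ω => by
        change |v + X ω| ≤ v + 1 + X ω ^ 2
        have h2 := abs_add_le v (X ω)
        rw [abs_of_nonneg hv0] at h2
        have h3 : |X ω| ≤ 1 + X ω ^ 2 := by
          rw [← sq_abs]
          nlinarith [sq_nonneg (|X ω| - 1), sq_nonneg (|X ω|)]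
        linarith)
    refine h1.trans ?_
    simp only [Pi.add_apply]
    rw [integral_add (integrable_const _) hC.memLp.integrable_sq]
    simp only [integral_const, probReal_univ, smul_eq_mul, one_mul]
    have := hC.integral_sq_le
    linarith
  · refine ⟨h.integral_sq_self_le.1, h.integral_sq_self_le.2.trans ?_⟩
    linarith

end single

/-- Second moment of a sum of independent centred random variables. -/
theorem integral_sum_sq_le {Ω : Type*} [MeasurableSpace Ω] {P : Measure Ω}
    [IsProbabilityMeasure P] {X : ℕ → Ω → ℝ} {e : ℕ → ℝ} (hind : iIndepFun X P)
    (hX : ∀ i, CenteredBound P (X i) (e i)) (s : Finset ℕ) :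
    Integrable (fun ω => (∑ i ∈ s, X i ω) ^ 2) P ∧
      ∫ ω, (∑ i ∈ s, X i ω) ^ 2 ∂P ≤ ∑ i ∈ s, e i := by
  have hm : MemLp (fun ω => ∑ i ∈ s, X i ω) 2 P := memLp_finsetSum s fun i _ => (hX i).memLp
  refine ⟨hm.integrable_sq, ?_⟩
  have h0 : ∫ ω, ∑ i ∈ s, X i ω ∂P = 0 := by
    rw [integral_finsetSum _ fun i _ => (hX i).memLp.integrable one_le_two]
    exact Finset.sum_eq_zero fun i _ => (hX i).integral_eq
  have hv := IndepFun.variance_sum (X := X) (s := s) (fun i _ => (hX i).memLp)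
    (fun i _ j _ hij => hind.indepFun hij)
  have e1 : (∑ i ∈ s, X i) = fun ω => ∑ i ∈ s, X i ω := by
    funext ω
    simp
  rw [e1, variance_of_integral_eq_zero hm.aestronglyMeasurable.aemeasurable h0] at hv
  rw [hv]
  refine Finset.sum_le_sum fun i _ => ?_
  rw [variance_of_integral_eq_zero (hX i).memLp.aestronglyMeasurable.aemeasurable
    (hX i).integral_eq]
  exact (hX i).integral_sq_le

/-- The right-hand side of `exists_chain_bound`. -/
noncomputable def chainSum (p m : ℕ) (s : ℕ → Finset ℕ) (z : ℕ → ℝ) : ℝ :=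
  2 * ∑ k ∈ Finset.range (p / m + 1), (∑ i ∈ s k, z i) ^ 2 + 2 * m * ∑ i ∈ Finset.range p, z i ^ 2

/-- A bound for the discrepancy that does not depend on `γ`. -/
noncomputable def majorant (F : Family) (p m : ℕ) (s : ℕ → Finset ℕ) (θ τ : ℕ → ℝ) (ε : ℝ)
    (y : ℕ → ℝ) : ℝ :=
  3 * ε + (∑ i ∈ Finset.range p, (varEst F (τ i) (y i) - (y i - θ i) ^ 2)) ^ 2 / (p ^ 2 * ε) +
    2 * chainSum p m s (fun i => (y i - θ i) * y i - varEst F (τ i) (y i)) / (p ^ 2 * ε) +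
    ε * ((∑ i ∈ Finset.range p, y i ^ 2) / p) + chainSum p m s (fun i => y i - θ i) / (p ^ 2 * ε) +
    2 / p ^ 2 * ∑ i ∈ Finset.range p, |varEst F (τ i) (y i)|

theorem ure_sub_loss_eq (F : Family) {p : ℕ} (θ τ y : ℕ → ℝ) (hτ : ∀ i, 0 < τ i)
    {γ : ℝ} (hγ : 0 ≤ γ) :
    ure F p τ y γ - loss p θ (shrink p τ y γ) =
      (∑ i ∈ Finset.range p, (varEst F (τ i) (y i) - (y i - θ i) ^ 2)) / p +
      2 / p ^ 2 * ∑ i ∈ Finset.range p, γ / (τ i + γ) * varEst F (τ i) (y i) +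
      2 * ((∑ i ∈ Finset.range p, γ / (τ i + γ) *
        ((y i - θ i) * y i - varEst F (τ i) (y i))) / p) -
      2 * (grandMean p y * ((∑ i ∈ Finset.range p, γ / (τ i + γ) * (y i - θ i)) / p)) := by
  simp only [ure, loss, shrink, Finset.mul_sum, Finset.sum_div]
  rw [← Finset.sum_sub_distrib, ← Finset.sum_add_distrib, ← Finset.sum_add_distrib,
    ← Finset.sum_sub_distrib]
  refine Finset.sum_congr rfl fun i _ => ?_
  have h1 : τ i / (τ i + γ) = 1 - γ / (τ i + γ) := by
    have : τ i + γ ≠ 0 := by have := hτ i; positivity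
    field_simp
    ring
  have h2 : γ ^ 2 / (τ i + γ) ^ 2 = (γ / (τ i + γ)) ^ 2 := by rw [div_pow]
  rw [h1, h2]
  unfold varEst
  ring

theorem discrepancy_le_majorant (F : Family) {p m : ℕ} (hp : 0 < p) {θ τ y : ℕ → ℝ}
    (hτ : ∀ i, 0 < τ i) {s : ℕ → Finset ℕ}
    (hs : ∀ (z : ℕ → ℝ) (γ : ℝ), 0 ≤ γ →
      (∑ i ∈ Finset.range p, γ / (τ i + γ) * z i) ^ 2 ≤ chainSum p m s z)
    {ε : ℝ} (hε : 0 < ε) {γ : ℝ} (hγ : 0 ≤ γ) :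
    discrepancy F p θ τ y γ ≤ majorant F p m s θ τ ε y := by
  have hp' : (0 : ℝ) < p := by exact_mod_cast hp
  unfold discrepancy
  rw [ure_sub_loss_eq F θ τ y hτ hγ]
  unfold majorant
  have hZ := hs (fun i => (y i - θ i) * y i - varEst F (τ i) (y i)) γ hγ
  have hU := hs (fun i => y i - θ i) γ hγ
  have hW : |∑ i ∈ Finset.range p, γ / (τ i + γ) * varEst F (τ i) (y i)| ≤
      ∑ i ∈ Finset.range p, |varEst F (τ i) (y i)| := by
    refine (Finset.abs_sum_le_sum_abs _ _).trans (Finset.sum_le_sum fun i _ => ?_)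
    have h0 : 0 < τ i + γ := by have := hτ i; positivity
    rw [abs_mul, abs_of_nonneg (div_nonneg hγ h0.le)]
    exact mul_le_of_le_one_left (abs_nonneg _)
      ((div_le_one h0).2 (by have := hτ i; linarith))
  have hG : grandMean p y ^ 2 ≤ (∑ i ∈ Finset.range p, y i ^ 2) / p := by
    have h1 := sq_sum_le_card_mul_sum_sq (s := Finset.range p) (f := y)
    rw [Finset.card_range] at h1
    unfold grandMean
    rw [mul_pow, le_div_iff₀ hp']
    have e : (1 / (p : ℝ)) ^ 2 * (∑ i ∈ Finset.range p, y i) ^ 2 * p =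
      (∑ i ∈ Finset.range p, y i) ^ 2 / p := by field_simp
    rw [e, div_le_iff₀ hp']
    linarith
  set SA := ∑ i ∈ Finset.range p, (varEst F (τ i) (y i) - (y i - θ i) ^ 2)
  set SW := ∑ i ∈ Finset.range p, γ / (τ i + γ) * varEst F (τ i) (y i)
  set SZ := ∑ i ∈ Finset.range p, γ / (τ i + γ) * ((y i - θ i) * y i - varEst F (τ i) (y i))
  set SU := ∑ i ∈ Finset.range p, γ / (τ i + γ) * (y i - θ i)
  set G := grandMean p y
  set CZ := chainSum p m s (fun i => (y i - θ i) * y i - varEst F (τ i) (y i))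
  set CU := chainSum p m s (fun i => y i - θ i)
  have amgm : ∀ x : ℝ, |x / p| ≤ ε + x ^ 2 / (p ^ 2 * ε) := by
    intro x
    have e : x ^ 2 / (p ^ 2 * ε) = |x / p| ^ 2 / ε := by
      rw [sq_abs, div_pow, div_div]
    rw [e]
    have h1 : |x / p| ^ 2 / ε * ε = |x / p| ^ 2 := div_mul_cancel₀ _ hε.ne'
    have h2 : 0 ≤ |x / p| ^ 2 / ε := by positivity
    nlinarith [sq_nonneg (ε - |x / p|), abs_nonneg (x / p)]
  have a1 := amgm SA
  have a2 := (amgm SZ).trans (add_le_add_right (div_le_div_of_nonneg_right hZ (by positivity)) ε)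
  have a3 : 2 * |G * (SU / p)| ≤ ε * G ^ 2 + CU / (p ^ 2 * ε) := by
    have h1 : CU / (p ^ 2 * ε) ≥ (SU / p) ^ 2 / ε := by
      rw [div_pow, div_div]
      exact div_le_div_of_nonneg_right hU (by positivity)
    have h2 : (SU / p) ^ 2 / ε * ε = (SU / p) ^ 2 := div_mul_cancel₀ _ hε.ne'
    have h3 : 0 ≤ ε * (ε * G ^ 2 + (SU / p) ^ 2 / ε - 2 * |G * (SU / p)|) := by
      rw [abs_mul]
      rw [← sq_abs (SU / p)] at h2 ⊢
      rw [← sq_abs G]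
      nlinarith [sq_nonneg (ε * |G| - |SU / p|)]
    have h4 := nonneg_of_mul_nonneg_right h3 hε
    linarith
  have a4 : ε * G ^ 2 ≤ ε * ((∑ i ∈ Finset.range p, y i ^ 2) / p) :=
    mul_le_mul_of_nonneg_left hG hε.le
  have a5 : |2 / (p : ℝ) ^ 2 * SW| ≤
      2 / p ^ 2 * ∑ i ∈ Finset.range p, |varEst F (τ i) (y i)| := by
    rw [abs_mul, abs_of_nonneg (by positivity : (0 : ℝ) ≤ 2 / p ^ 2)]
    exact mul_le_mul_of_nonneg_left hW (by positivity)
  have a6 : |SA / p + 2 / p ^ 2 * SW + 2 * (SZ / p) - 2 * (G * (SU / p))| ≤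
      |SA / p| + |2 / (p : ℝ) ^ 2 * SW| + 2 * |SZ / p| + 2 * |G * (SU / p)| := by
    rw [abs_le]
    constructor <;>
    linarith [neg_abs_le (SA / p), neg_abs_le (2 / (p : ℝ) ^ 2 * SW), neg_abs_le (SZ / p),
      neg_abs_le (G * (SU / p)), le_abs_self (SA / p), le_abs_self (2 / (p : ℝ) ^ 2 * SW),
      le_abs_self (SZ / p), le_abs_self (G * (SU / p))]
  have e2 : 2 * CZ / (p ^ 2 * ε) = 2 * (CZ / (p ^ 2 * ε)) := by ring
  rw [e2]
  linarith

theorem discrepancy_nonneg (F : Family) (p : ℕ) (θ τ y : ℕ → ℝ) (γ : ℝ) :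
    0 ≤ discrepancy F p θ τ y γ := abs_nonneg _

theorem discrepancy_zero (F : Family) (θ τ y : ℕ → ℝ) (γ : ℝ) : discrepancy F 0 θ τ y γ = 0 := by
  simp [discrepancy, ure, loss]

theorem bddAbove_discrepancy (F : Family) (p : ℕ) (θ τ y : ℕ → ℝ) (hτ : ∀ i, 0 < τ i) :
    BddAbove (Set.range fun γ : Set.Ici (0 : ℝ) => discrepancy F p θ τ y γ) := by
  rcases p.eq_zero_or_pos with rfl | hp
  · refine ⟨0, ?_⟩
    rintro _ ⟨γ, rfl⟩
    exact (discrepancy_zero F θ τ y γ).le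
  · obtain ⟨s, -, hs⟩ := exists_chain_bound τ hτ (p := p) one_pos
    refine ⟨majorant F p 1 s θ τ 1 y, ?_⟩
    rintro _ ⟨γ, rfl⟩
    exact discrepancy_le_majorant F hp hτ hs one_pos γ.2

theorem supDiscrepancy_nonneg (F : Family) (p : ℕ) (θ τ y : ℕ → ℝ) :
    0 ≤ supDiscrepancy F p θ τ y :=
  Real.iSup_nonneg fun _ => discrepancy_nonneg _ _ _ _ _ _

theorem continuous_discrepancy (F : Family) (p : ℕ) (θ τ y : ℕ → ℝ) (hτ : ∀ i, 0 < τ i) :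
    Continuous fun γ : Set.Ici (0 : ℝ) => discrepancy F p θ τ y γ := by
  have hne : ∀ i, ∀ γ : Set.Ici (0 : ℝ), τ i + (γ : ℝ) ≠ 0 := by
    intro i γ
    have h1 := hτ i
    have h2 : (0 : ℝ) ≤ γ := γ.2
    positivity
  have hb : ∀ i, Continuous fun γ : Set.Ici (0 : ℝ) => (γ : ℝ) / (τ i + γ) := fun i =>
    continuous_subtype_val.div (by fun_prop) (hne i)
  have ha : ∀ i, Continuous fun γ : Set.Ici (0 : ℝ) => τ i / (τ i + (γ : ℝ)) := fun i =>
    continuous_const.div (by fun_prop) (hne i)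
  unfold discrepancy ure loss shrink
  simp only [← div_pow]
  fun_prop

theorem measurable_discrepancy (F : Family) (p : ℕ) (θ τ : ℕ → ℝ) (γ : ℝ) :
    Measurable fun y : ℕ → ℝ => discrepancy F p θ τ y γ := by
  unfold discrepancy ure loss shrink grandMean Family.V
  simp only [← Real.norm_eq_abs]
  fun_prop

theorem measurable_supDiscrepancy (F : Family) (p : ℕ) (θ τ : ℕ → ℝ) (hτ : ∀ i, 0 < τ i) :
    Measurable fun y : ℕ → ℝ => supDiscrepancy F p θ τ y := by
  refine measurable_of_Ioi fun a => ?_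
  have e : (fun y : ℕ → ℝ => supDiscrepancy F p θ τ y) ⁻¹' Set.Ioi a =
      ⋃ n : ℕ, {y | a < discrepancy F p θ τ y
        (TopologicalSpace.denseSeq (Set.Ici (0 : ℝ)) n : ℝ)} := by
    ext y
    simp only [Set.mem_preimage, Set.mem_Ioi, Set.mem_iUnion, Set.mem_ofPred_eq]
    constructor
    · intro h
      obtain ⟨γ, hγ⟩ := exists_lt_of_lt_ciSup h
      exact (TopologicalSpace.denseRange_denseSeq (Set.Ici (0 : ℝ))).exists_mem_open
        (isOpen_Ioi.preimage (continuous_discrepancy F p θ τ y hτ)) ⟨γ, hγ⟩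
    · rintro ⟨n, hn⟩
      exact hn.trans_le (le_ciSup (bddAbove_discrepancy F p θ τ y hτ) _)
  rw [e]
  exact MeasurableSet.iUnion fun n => measurableSet_lt measurable_const
    (measurable_discrepancy F p θ τ _)

section

variable {Ω : Type*} [MeasurableSpace Ω] {P : Measure Ω} [IsProbabilityMeasure P]

theorem integral_chainSum_le {X : ℕ → Ω → ℝ} {e : ℕ → ℝ} (he : ∀ i, 0 ≤ e i)
    (hind : iIndepFun X P) (hX : ∀ i, CenteredBound P (X i) (e i)) {p m : ℕ} {s : ℕ → Finset ℕ}
    (hs : ∀ k < p / m + 1, s k ⊆ Finset.range p) :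
    Integrable (fun ω => chainSum p m s fun i => X i ω) P ∧
      ∫ ω, chainSum p m s (fun i => X i ω) ∂P ≤
        (2 * ((p / m : ℕ) + 1) + 2 * m) * ∑ i ∈ Finset.range p, e i := by
  have i1 : Integrable (fun ω => 2 * ∑ k ∈ Finset.range (p / m + 1),
      (∑ i ∈ s k, X i ω) ^ 2) P :=
    (integrable_finsetSum _ fun k _ => (integral_sum_sq_le hind hX (s k)).1).const_mul _
  have i2 : Integrable (fun ω => 2 * (m : ℝ) * ∑ i ∈ Finset.range p, X i ω ^ 2) P :=
    (integrable_finsetSum _ fun i _ => (hX i).memLp.integrable_sq).const_mul _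
  unfold chainSum
  refine ⟨i1.add i2, ?_⟩
  rw [integral_add i1 i2, integral_const_mul, integral_const_mul,
    integral_finsetSum _ fun k _ => (integral_sum_sq_le hind hX (s k)).1,
    integral_finsetSum _ fun i _ => (hX i).memLp.integrable_sq]
  have h1 : ∑ k ∈ Finset.range (p / m + 1), ∫ ω, (∑ i ∈ s k, X i ω) ^ 2 ∂P ≤
      ∑ k ∈ Finset.range (p / m + 1), ∑ i ∈ Finset.range p, e i := by
    refine Finset.sum_le_sum fun k hk => ?_
    exact (integral_sum_sq_le hind hX (s k)).2.trans
      (Finset.sum_le_sum_of_subset_of_nonneg (hs k (Finset.mem_range.1 hk)) fun i _ _ => he i)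
  rw [Finset.sum_const, Finset.card_range, nsmul_eq_mul] at h1
  push_cast at h1
  have h2 : ∑ i ∈ Finset.range p, ∫ ω, X i ω ^ 2 ∂P ≤ ∑ i ∈ Finset.range p, e i :=
    Finset.sum_le_sum fun i _ => (hX i).integral_sq_le
  have h3 := mul_le_mul_of_nonneg_left h2 (by positivity : (0 : ℝ) ≤ 2 * m)
  linarith

variable {F : Family} {θ τ e : ℕ → ℝ} {Y : ℕ → Ω → ℝ}

/-- The moment estimates of `FourthMomentBounds.estimates` for all observations. -/
structure SequenceBounds (P : Measure Ω) (F : Family) (θ τ e : ℕ → ℝ) (Y : ℕ → Ω → ℝ) : Prop where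
  nonneg : ∀ i, 0 ≤ e i
  aemeasurable : ∀ i, AEMeasurable (Y i) P
  indep : iIndepFun Y P
  varEst_sub : ∀ i, CenteredBound P
    (fun ω => varEst F (τ i) (Y i ω) - (Y i ω - θ i) ^ 2) (e i)
  mul_sub_varEst : ∀ i, CenteredBound P
    (fun ω => (Y i ω - θ i) * Y i ω - varEst F (τ i) (Y i ω)) (e i)
  sub_mean : ∀ i, CenteredBound P (fun ω => Y i ω - θ i) (e i)
  integrable_varEst : ∀ i, Integrable (fun ω => |varEst F (τ i) (Y i ω)|) P
  integral_varEst_le : ∀ i, ∫ ω, |varEst F (τ i) (Y i ω)| ∂P ≤ e i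
  integrable_sq : ∀ i, Integrable (fun ω => Y i ω ^ 2) P
  integral_sq_le : ∀ i, ∫ ω, Y i ω ^ 2 ∂P ≤ e i

theorem measurable_varEst (F : Family) (t : ℝ) : Measurable (varEst F t) := by
  unfold varEst Family.V
  fun_prop

theorem SequenceBounds.integral_majorant_le (h : SequenceBounds P F θ τ e Y) {p m : ℕ}
    {s : ℕ → Finset ℕ} (hs : ∀ k < p / m + 1, s k ⊆ Finset.range p) {ε : ℝ} (hε : 0 < ε) :
    Integrable (fun ω => majorant F p m s θ τ ε fun i => Y i ω) P ∧
      ∫ ω, majorant F p m s θ τ ε (fun i => Y i ω) ∂P ≤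
        3 * ε + (∑ i ∈ Finset.range p, e i) / (p ^ 2 * ε) +
        2 * ((2 * ((p / m : ℕ) + 1) + 2 * m) * ∑ i ∈ Finset.range p, e i) / (p ^ 2 * ε) +
        ε * ((∑ i ∈ Finset.range p, e i) / p) +
        ((2 * ((p / m : ℕ) + 1) + 2 * m) * ∑ i ∈ Finset.range p, e i) / (p ^ 2 * ε) +
        2 / p ^ 2 * ∑ i ∈ Finset.range p, e i := by
  have hm := measurable_varEst F
  have dA := h.indep.comp (fun i y => varEst F (τ i) y - (y - θ i) ^ 2) fun i =>
    (hm (τ i)).sub (by fun_prop)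
  have dZ := h.indep.comp (fun i y => (y - θ i) * y - varEst F (τ i) y) fun i =>
    Measurable.sub (by fun_prop) (hm (τ i))
  have dU := h.indep.comp (fun i y => y - θ i) fun i => by fun_prop
  obtain ⟨iA, bA⟩ := integral_sum_sq_le dA h.varEst_sub (Finset.range p)
  obtain ⟨iZ, bZ⟩ := integral_chainSum_le h.nonneg dZ h.mul_sub_varEst hs
  obtain ⟨iU, bU⟩ := integral_chainSum_le h.nonneg dU h.sub_mean hs
  have iQ : Integrable (fun ω => ∑ i ∈ Finset.range p, Y i ω ^ 2) P :=
    integrable_finsetSum _ fun i _ => h.integrable_sq i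
  have iW : Integrable (fun ω => ∑ i ∈ Finset.range p, |varEst F (τ i) (Y i ω)|) P :=
    integrable_finsetSum _ fun i _ => h.integrable_varEst i
  have bQ : ∫ ω, ∑ i ∈ Finset.range p, Y i ω ^ 2 ∂P ≤ ∑ i ∈ Finset.range p, e i := by
    rw [integral_finsetSum _ fun i _ => h.integrable_sq i]
    exact Finset.sum_le_sum fun i _ => h.integral_sq_le i
  have bW : ∫ ω, ∑ i ∈ Finset.range p, |varEst F (τ i) (Y i ω)| ∂P ≤
      ∑ i ∈ Finset.range p, e i := by
    rw [integral_finsetSum _ fun i _ => h.integrable_varEst i]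
    exact Finset.sum_le_sum fun i _ => h.integral_varEst_le i
  simp only [Function.comp_apply] at iA bA iZ bZ iU bU
  have j0 : Integrable (fun _ : Ω => 3 * ε) P := integrable_const _
  have j1 := iA.div_const ((p : ℝ) ^ 2 * ε)
  have j2 := (iZ.const_mul 2).div_const ((p : ℝ) ^ 2 * ε)
  have j3 := (iQ.div_const (p : ℝ)).const_mul ε
  have j4 := iU.div_const ((p : ℝ) ^ 2 * ε)
  have j5 := iW.const_mul (2 / (p : ℝ) ^ 2)
  have key : ∀ {f₀ f₁ f₂ f₃ f₄ f₅ : Ω → ℝ}, Integrable f₀ P → Integrable f₁ P → Integrable f₂ P →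
      Integrable f₃ P → Integrable f₄ P → Integrable f₅ P →
      Integrable (fun ω => f₀ ω + f₁ ω + f₂ ω + f₃ ω + f₄ ω + f₅ ω) P ∧
      ∫ ω, (f₀ ω + f₁ ω + f₂ ω + f₃ ω + f₄ ω + f₅ ω) ∂P = ∫ ω, f₀ ω ∂P + ∫ ω, f₁ ω ∂P +
        ∫ ω, f₂ ω ∂P + ∫ ω, f₃ ω ∂P + ∫ ω, f₄ ω ∂P + ∫ ω, f₅ ω ∂P := by
    intro f₀ f₁ f₂ f₃ f₄ f₅ h₀ h₁ h₂ h₃ h₄ h₅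
    refine ⟨((((h₀.add h₁).add h₂).add h₃).add h₄).add h₅, ?_⟩
    rw [← integral_add' h₀ h₁, ← integral_add' (h₀.add h₁) h₂,
      ← integral_add' ((h₀.add h₁).add h₂) h₃, ← integral_add' (((h₀.add h₁).add h₂).add h₃) h₄,
      ← integral_add' ((((h₀.add h₁).add h₂).add h₃).add h₄) h₅]
    rfl
  obtain ⟨hi, heq⟩ := key j0 j1 j2 j3 j4 j5
  unfold majorant
  refine ⟨hi, heq.trans_le ?_⟩
  simp only [integral_const_mul, integral_div, integral_const, probReal_univ, smul_eq_mul, one_mul]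
  gcongr

/-- The expected supremum of the discrepancy is at most of order `p ^ (-1/4)`. -/
theorem SequenceBounds.integral_supDiscrepancy_le (h : SequenceBounds P F θ τ e Y)
    (hτ : ∀ i, 0 < τ i) {p : ℕ} (hp : 0 < p) {L : ℝ}
    (hL : ∑ i ∈ Finset.range p, e i ≤ L * p) :
    Integrable (fun ω => supDiscrepancy F p θ τ fun i => Y i ω) P ∧
      ∫ ω, supDiscrepancy F p θ τ (fun i => Y i ω) ∂P ≤
        (3 + 32 * L) * √(1 / √p) + 2 * L * (1 / √p) := by
  have hp' : (0 : ℝ) < p := by exact_mod_cast hp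
  set m := Nat.sqrt p with hm
  have hm0 : 0 < m := Nat.sqrt_pos.2 hp
  obtain ⟨s, hs1, hs2⟩ := exists_chain_bound τ hτ (p := p) hm0
  set t : ℝ := 1 / √p with ht
  have hsp : 0 < √(p : ℝ) := Real.sqrt_pos.2 hp'
  have ht0 : 0 < t := by positivity
  set ε : ℝ := √t with hε
  have hε0 : 0 < ε := Real.sqrt_pos.2 ht0
  have hεt : ε ^ 2 = t := Real.sq_sqrt ht0.le
  obtain ⟨hi, hb⟩ := h.integral_majorant_le hs1 hε0
  have hle : ∀ y, supDiscrepancy F p θ τ y ≤ majorant F p m s θ τ ε y := fun y =>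
    ciSup_le fun γ => discrepancy_le_majorant F hp hτ hs2 hε0 γ.2
  have hmeas : AEStronglyMeasurable (fun ω => supDiscrepancy F p θ τ fun i => Y i ω) P :=
    ((measurable_supDiscrepancy F p θ τ hτ).comp_aemeasurable
      (aemeasurable_pi_lambda _ h.aemeasurable)).aestronglyMeasurable
  have hint : Integrable (fun ω => supDiscrepancy F p θ τ fun i => Y i ω) P := by
    refine hi.mono' hmeas (ae_of_all _ fun ω => ?_)
    rw [Real.norm_of_nonneg (supDiscrepancy_nonneg _ _ _ _ _)]
    exact hle _
  refine ⟨hint, (integral_mono hint hi fun ω => hle _).trans (hb.trans ?_)⟩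
  set E := ∑ i ∈ Finset.range p, e i
  have hE0 : 0 ≤ E := Finset.sum_nonneg fun i _ => h.nonneg i
  have hL0 : 0 ≤ L := by
    by_contra hneg
    have : L * p < 0 := mul_neg_of_neg_of_pos (not_le.1 hneg) hp'
    linarith
  have hmsq : (m : ℝ) ≤ √p := by
    rw [hm]
    exact Real.nat_sqrt_le_real_sqrt
  have hm1 : (1 : ℝ) ≤ m := by exact_mod_cast hm0
  have hdiv : ((p / m : ℕ) : ℝ) ≤ m + 2 := by
    have h1 : p / m ≤ m + 2 := by
      have h2 : p < (m + 1) * (m + 1) := Nat.lt_succ_sqrt p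
      have h3 : p / m < m + 3 := Nat.div_lt_of_lt_mul (by nlinarith)
      omega
    exact_mod_cast h1
  have hc : 2 * (((p / m : ℕ) : ℝ) + 1) + 2 * m ≤ 10 * √p := by linarith
  have hcE : (2 * (((p / m : ℕ) : ℝ) + 1) + 2 * m) * E ≤ 10 * √p * E :=
    mul_le_mul_of_nonneg_right hc hE0
  have hEp : E / p ≤ L := by rwa [div_le_iff₀ hp']
  have hsq : √(p : ℝ) ^ 2 = p := Real.sq_sqrt hp'.le
  have ht2 : t ^ 2 = 1 / p := by rw [ht, div_pow, hsq, one_pow]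
  have ht1 : t ≤ 1 := by
    rw [ht, div_le_one hsp]
    exact hm1.trans hmsq
  have q0 : E / (p ^ 2) ≤ L * t := by
    have e1 : E / (p : ℝ) ^ 2 = E / p * t ^ 2 := by rw [ht2]; field_simp
    rw [e1]
    have : t ^ 2 ≤ t := by nlinarith
    exact mul_le_mul hEp this (sq_nonneg _) hL0
  have q1 : (10 * √p * E) / p ^ 2 ≤ 10 * L * t := by
    have e1 : (10 * √p * E) / (p : ℝ) ^ 2 = 10 * (E / p) * t := by
      have e2 : ∀ r : ℝ, 0 < r → (10 * r * E) / (r ^ 2) ^ 2 = 10 * (E / r ^ 2) * (1 / r) := by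
        intro r hr
        field_simp
      have e3 := e2 _ hsp
      rwa [hsq] at e3
    rw [e1]
    nlinarith [mul_le_mul_of_nonneg_right hEp ht0.le]
  have hdε : ∀ {a b : ℝ}, a / p ^ 2 ≤ b * t → a / (p ^ 2 * ε) ≤ b * ε := by
    intro a b hab
    rw [← div_div, div_le_iff₀ hε0]
    calc a / p ^ 2 ≤ b * t := hab
      _ = b * ε * ε := by rw [← hεt]; ring
  have r0 := hdε q0
  have r1 := hdε q1
  have r2 : ((2 * (((p / m : ℕ) : ℝ) + 1) + 2 * m) * E) / (p ^ 2 * ε) ≤ 10 * L * ε :=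
    (div_le_div_of_nonneg_right hcE (by positivity)).trans r1
  have r3 : 2 * ((2 * (((p / m : ℕ) : ℝ) + 1) + 2 * m) * E) / (p ^ 2 * ε) =
      2 * (((2 * (((p / m : ℕ) : ℝ) + 1) + 2 * m) * E) / (p ^ 2 * ε)) := by ring
  have r4 : ε * (E / p) ≤ ε * L := mul_le_mul_of_nonneg_left hEp hε0.le
  have r5 : 2 / (p : ℝ) ^ 2 * E = 2 * (E / p ^ 2) := by ring
  rw [r3, r5]
  linarith

theorem SequenceBounds.conclusion (h : SequenceBounds P F θ τ e Y) (hτ : ∀ i, 0 < τ i)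
    (hO : (fun p : ℕ => ∑ i ∈ Finset.range p, e i) =O[atTop] (fun p : ℕ => (p : ℝ))) :
    (∀ p : ℕ, Integrable (fun ω => supDiscrepancy F p θ τ fun i => Y i ω) P) ∧
    Tendsto (fun p : ℕ => eLpNorm (fun ω => supDiscrepancy F p θ τ fun i => Y i ω) 1 P)
      atTop (𝓝 0) ∧
    TendstoInMeasure P (fun (p : ℕ) ω => supDiscrepancy F p θ τ fun i => Y i ω)
      atTop (fun _ => 0) := by
  have hint : ∀ p : ℕ, Integrable (fun ω => supDiscrepancy F p θ τ fun i => Y i ω) P := by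
    intro p
    rcases p.eq_zero_or_pos with rfl | hp
    · have e0 : (fun ω => supDiscrepancy F 0 θ τ fun i => Y i ω) = fun _ => (0 : ℝ) := by
        funext ω
        simp [supDiscrepancy, discrepancy_zero]
      rw [e0]
      exact integrable_zero _ _ _
    · have hp' : (0 : ℝ) < p := by exact_mod_cast hp
      exact (h.integral_supDiscrepancy_le hτ hp
        (L := (∑ i ∈ Finset.range p, e i) / p) (by rw [div_mul_cancel₀ _ hp'.ne'])).1
  obtain ⟨L, hL⟩ := hO.bound
  have h0 : Tendsto (fun p : ℕ => ∫ ω, supDiscrepancy F p θ τ (fun i => Y i ω) ∂P)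
      atTop (𝓝 0) := by
    have hlim : Tendsto (fun p : ℕ => (3 + 32 * L) * √(1 / √(p : ℝ)) + 2 * L * (1 / √(p : ℝ)))
        atTop (𝓝 0) := by
      have t1 : Tendsto (fun p : ℕ => 1 / √(p : ℝ)) atTop (𝓝 0) := by
        simp only [one_div]
        exact tendsto_inv_atTop_zero.comp
          (Real.tendsto_sqrt_atTop.comp tendsto_natCast_atTop_atTop)
      have t2 := (Real.continuous_sqrt.tendsto 0).comp t1
      rw [Real.sqrt_zero] at t2
      simpa using (t2.const_mul (3 + 32 * L)).add (t1.const_mul (2 * L))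
    refine squeeze_zero' (Eventually.of_forall fun p =>
      integral_nonneg fun ω => supDiscrepancy_nonneg _ _ _ _ _) ?_ hlim
    filter_upwards [hL, eventually_gt_atTop 0] with p hp1 hp0
    refine (h.integral_supDiscrepancy_le hτ hp0 ?_).2
    simpa [abs_of_nonneg (Finset.sum_nonneg fun i _ => h.nonneg i)] using hp1
  have h1 : Tendsto (fun p : ℕ => eLpNorm (fun ω => supDiscrepancy F p θ τ fun i => Y i ω) 1 P)
      atTop (𝓝 0) := by
    have e : ∀ p : ℕ, eLpNorm (fun ω => supDiscrepancy F p θ τ fun i => Y i ω) 1 P =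
        ENNReal.ofReal (∫ ω, supDiscrepancy F p θ τ (fun i => Y i ω) ∂P) := by
      intro p
      rw [eLpNorm_one_eq_lintegral_enorm, ← ofReal_integral_norm_eq_lintegral_enorm (hint p)]
      congr 1
      refine integral_congr_ae (ae_of_all _ fun ω => ?_)
      exact Real.norm_of_nonneg (supDiscrepancy_nonneg _ _ _ _ _)
    simp only [e]
    simpa using ENNReal.tendsto_ofReal h0
  refine ⟨hint, h1, ?_⟩
  refine tendstoInMeasure_of_tendsto_eLpNorm one_ne_zero
    (fun p => (hint p).aestronglyMeasurable) aestronglyMeasurable_const ?_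
  simpa [Pi.sub_def] using h1

end

/-- The first four moments of `ν` exist and are `m₁, …, m₄`. -/
structure RawMoments (ν : Measure ℝ) (m₁ m₂ m₃ m₄ : ℝ) : Prop where
  integrable_pow : ∀ k ≤ 4, Integrable (fun x : ℝ => x ^ k) ν
  first : ∫ x, x ^ 1 ∂ν = m₁
  second : ∫ x, x ^ 2 ∂ν = m₂
  third : ∫ x, x ^ 3 ∂ν = m₃
  fourth : ∫ x, x ^ 4 ∂ν = m₄

theorem RawMoments.fourthMomentBounds {ν : Measure ℝ} [IsProbabilityMeasure ν]
    {m₁ m₂ m₃ m₄ t θ v A : ℝ} (h : RawMoments ν m₁ m₂ m₃ m₄) (h1 : m₁ / t = θ)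
    (h2 : m₂ / t ^ 2 - θ ^ 2 = v)
    (h4 : m₄ / t ^ 4 - 4 * θ * (m₃ / t ^ 3) + 6 * θ ^ 2 * (m₂ / t ^ 2) - 3 * θ ^ 4 ≤ A)
    (h5 : θ ^ 2 * v ≤ A) (h6 : θ ^ 2 ≤ A) :
    FourthMomentBounds (ν.map fun x => x / t) (fun x => x) θ v A := by
  have hm : AEMeasurable (fun x : ℝ => x / t) ν := by fun_prop
  have i1 := h.integrable_pow 1 (by norm_num)
  have i2 := h.integrable_pow 2 (by norm_num)
  have i3 := h.integrable_pow 3 (by norm_num)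
  have i4 := h.integrable_pow 4 (by norm_num)
  have j1 : Integrable (fun x : ℝ => -2 * θ / t * x ^ 1 + θ ^ 2) ν :=
    (i1.const_mul _).add (integrable_const _)
  have j2 : Integrable (fun x : ℝ => 6 * θ ^ 2 / t ^ 2 * x ^ 2) ν := i2.const_mul _
  have j3 : Integrable (fun x : ℝ => -4 * θ / t ^ 3 * x ^ 3) ν := i3.const_mul _
  have j4 : Integrable (fun x : ℝ => 1 / t ^ 4 * x ^ 4) ν := i4.const_mul _
  have j1' : Integrable (fun x : ℝ => -4 * θ ^ 3 / t * x ^ 1 + θ ^ 4) ν :=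
    (i1.const_mul _).add (integrable_const _)
  have j2' : Integrable (fun x : ℝ => 1 / t ^ 2 * x ^ 2) ν := i2.const_mul _
  have e4 : ∀ x : ℝ, (x / t - θ) ^ 4 = 1 / t ^ 4 * x ^ 4 + (-4 * θ / t ^ 3 * x ^ 3 +
      (6 * θ ^ 2 / t ^ 2 * x ^ 2 + (-4 * θ ^ 3 / t * x ^ 1 + θ ^ 4))) := by
    intro x
    ring
  have e2 : ∀ x : ℝ, (x / t - θ) ^ 2 = 1 / t ^ 2 * x ^ 2 + (-2 * θ / t * x ^ 1 + θ ^ 2) := by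
    intro x
    ring
  have k2 : Integrable (fun x : ℝ => 6 * θ ^ 2 / t ^ 2 * x ^ 2 +
      (-4 * θ ^ 3 / t * x ^ 1 + θ ^ 4)) ν := j2.add j1'
  have k3 : Integrable (fun x : ℝ => -4 * θ / t ^ 3 * x ^ 3 + (6 * θ ^ 2 / t ^ 2 * x ^ 2 +
      (-4 * θ ^ 3 / t * x ^ 1 + θ ^ 4))) ν := j3.add k2
  have k4 : Integrable (fun x : ℝ => (x / t - θ) ^ 4) ν := by
    simp only [e4]
    exact j4.add k3
  refine ⟨aemeasurable_id, ?_, ?_, ?_, ?_, h5, h6⟩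
  · rw [integrable_map_measure (by fun_prop) hm]
    exact k4
  · rw [integral_map hm (by fun_prop), integral_div, ← h1, ← h.first]
    simp
  · rw [integral_map hm (by fun_prop)]
    simp only [e2]
    rw [integral_add j2' j1, integral_add (i1.const_mul _) (integrable_const _),
      integral_const_mul, integral_const_mul, h.first, h.second, ← h2, ← h1]
    simp
    ring
  · rw [integral_map hm (by fun_prop)]
    simp only [e4]
    rw [integral_add j4 k3, integral_add j3 k2, integral_add j2 j1',
      integral_add (i1.const_mul _) (integrable_const _), integral_const_mul, integral_const_mul,
      integral_const_mul, integral_const_mul, h.first, h.second, h.third, h.fourth]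
    simp only [integral_const, probReal_univ, smul_eq_mul, one_mul]
    refine le_trans (le_of_eq ?_) h4
    have : m₁ * θ ^ 3 / t = θ ^ 4 := by rw [← h1]; ring
    linear_combination -4 * this

/-- Summability of `k ^ 4 m k` for weights with a recursion of Panjer type. -/
theorem summable_pow_four_mul_of_panjer {m : ℕ → ℝ} {a b : ℝ} (hm : ∀ k, 0 < m k)
    (hb0 : 0 ≤ b) (hb1 : b < 1) (ha : 0 < a)
    (hrec : ∀ k : ℕ, ((k : ℝ) + 1) * m (k + 1) = (a + b * k) * m k) :
    Summable fun k : ℕ => m k * (k : ℝ) ^ 4 := by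
  refine summable_of_ratio_test_tendsto_lt_one hb1 ?_ ?_
  · filter_upwards [eventually_gt_atTop 0] with k hk
    have : (0 : ℝ) < k := by exact_mod_cast hk
    have := hm k
    positivity
  · have t1 : Tendsto (fun k : ℕ => (1 : ℝ) / (k : ℝ)) atTop (𝓝 0) :=
      tendsto_one_div_atTop_nhds_zero_nat
    have t2 : Tendsto (fun k : ℕ => (1 + (1 : ℝ) / k) ^ 3 * (a * (1 / k) + b)) atTop (𝓝 b) := by
      have := ((t1.const_add 1).pow 3).mul ((t1.const_mul a).add_const b)
      simpa using this
    refine t2.congr' ?_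
    filter_upwards [eventually_gt_atTop 0] with k hk
    have hk' : (0 : ℝ) < k := by exact_mod_cast hk
    have h1 := hm k
    have h2 := hm (k + 1)
    have hr : m (k + 1) = (a + b * k) * m k / (k + 1) := by
      rw [eq_div_iff (by positivity), ← hrec k]
      ring
    rw [Real.norm_of_nonneg (by positivity), Real.norm_of_nonneg (by positivity), hr]
    push_cast
    field_simp

/-- The first four moments of a distribution on `ℕ` whose masses satisfy
`(k + 1) m (k + 1) = (a + b k) m k`, in terms of the mean `μ = a / (1 - b)` and `s = 1 / (1 - b)`.
-/
theorem rawMoments_of_panjer {m : ℕ → ℝ} {a b μ s : ℝ} (hm : ∀ k, 0 < m k)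
    (hb0 : 0 ≤ b) (hb1 : b < 1) (ha : 0 < a)
    (hrec : ∀ k : ℕ, ((k : ℝ) + 1) * m (k + 1) = (a + b * k) * m k)
    (hμ : μ * (1 - b) = a) (hs : s * (1 - b) = 1) {ν : Measure ℕ} [IsProbabilityMeasure ν]
    (hν : ν = Measure.sum fun k : ℕ => ENNReal.ofReal (m k) • Measure.dirac k) :
    RawMoments (ν.map (Nat.cast : ℕ → ℝ)) μ (μ ^ 2 + s * μ)
      (μ ^ 3 + 3 * s * μ ^ 2 + (2 * s ^ 2 - s) * μ)
      (μ ^ 4 + 6 * s * μ ^ 3 + (11 * s ^ 2 - 4 * s) * μ ^ 2 +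
        (6 * s ^ 3 - 6 * s ^ 2 + s) * μ) := by
  have hs4 := summable_pow_four_mul_of_panjer hm hb0 hb1 ha hrec
  have hcast : Measurable (Nat.cast : ℕ → ℝ) := by fun_prop
  have hint4 : Integrable (fun k : ℕ => (k : ℝ) ^ 4) ν := by
    rw [hν, integrable_sum_dirac_iff (by simp)]
    refine hs4.congr fun k => ?_
    rw [ENNReal.toReal_ofReal (hm k).le, Real.norm_of_nonneg (by positivity)]
  have hint : ∀ j ≤ 4, Integrable (fun k : ℕ => (k : ℝ) ^ j) ν := by
    intro j hj
    refine ((integrable_const 1).add hint4).mono' (by fun_prop) (ae_of_all _ fun k => ?_)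
    rw [Real.norm_of_nonneg (by positivity)]
    change (k : ℝ) ^ j ≤ 1 + (k : ℝ) ^ 4
    rcases k.eq_zero_or_pos with rfl | hk
    · rcases j.eq_zero_or_pos with rfl | hj0
      · simp
      · simp [hj0.ne']
    · have : (k : ℝ) ^ j ≤ (k : ℝ) ^ 4 := pow_le_pow_right₀ (by exact_mod_cast hk) hj
      linarith
  set S : ℕ → ℝ := fun j => ∫ k, (k : ℝ) ^ j ∂ν with hS
  have hsum : ∀ j ≤ 4, HasSum (fun k : ℕ => m k * (k : ℝ) ^ j) (S j) := by
    intro j hj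
    have hi := hint j hj
    have hsm : Summable fun k : ℕ => (ENNReal.ofReal (m k)).toReal * ‖(k : ℝ) ^ j‖ := by
      rwa [hν, integrable_sum_dirac_iff (by simp)] at hi
    have h1 := hasSum_integral_sum_dirac (c := fun k => ENNReal.ofReal (m k))
      (x := fun k : ℕ => k) (f := fun k : ℕ => (k : ℝ) ^ j) (by simp) hsm
    rw [← hν] at h1
    refine h1.congr_fun fun k => ?_
    rw [ENNReal.toReal_ofReal (hm k).le, smul_eq_mul]
  have hshift : ∀ j ≤ 3, HasSum (fun k : ℕ => (a + b * k) * m k * ((k : ℝ) + 1) ^ j)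
      (S (j + 1)) := by
    intro j hj
    have h1 := (hasSum_nat_add_iff' 1).2 (hsum (j + 1) (by omega))
    simp only [Finset.range_one, Finset.sum_singleton, Nat.cast_zero, ne_eq, Nat.add_eq_zero_iff,
      one_ne_zero, and_false, not_false_eq_true, zero_pow, mul_zero, sub_zero] at h1
    refine h1.congr_fun fun k => ?_
    rw [← hrec k]
    push_cast
    ring
  have hS0 : S 0 = 1 := by simp [hS]
  have s0 := hsum 0 (by norm_num)
  have s1 := hsum 1 (by norm_num)
  have s2 := hsum 2 (by norm_num)
  have s3 := hsum 3 (by norm_num)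
  have s4 := hsum 4 (by norm_num)
  have q1 : S 1 = a * S 0 + b * S 1 := by
    refine (hshift 0 (by norm_num)).unique (((s0.mul_left a).add (s1.mul_left b)).congr_fun
      fun k => ?_)
    ring
  have q2 : S 2 = a * (S 1 + S 0) + b * (S 2 + S 1) := by
    refine (hshift 1 (by norm_num)).unique ((((s1.add s0).mul_left a).add
      ((s2.add s1).mul_left b)).congr_fun fun k => ?_)
    ring
  have q3 : S 3 = a * (S 2 + (2 * S 1 + S 0)) + b * (S 3 + (2 * S 2 + S 1)) := by
    refine (hshift 2 (by norm_num)).unique ((((s2.add ((s1.mul_left 2).add s0)).mul_left a).add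
      ((s3.add ((s2.mul_left 2).add s1)).mul_left b)).congr_fun fun k => ?_)
    ring
  have q4 : S 4 = a * (S 3 + (3 * S 2 + (3 * S 1 + S 0))) +
      b * (S 4 + (3 * S 3 + (3 * S 2 + S 1))) := by
    refine (hshift 3 (by norm_num)).unique ((((s3.add ((s2.mul_left 3).add
      ((s1.mul_left 3).add s0))).mul_left a).add ((s4.add ((s3.mul_left 3).add
      ((s2.mul_left 3).add s1))).mul_left b)).congr_fun fun k => ?_)
    ring
  have hne : (1 - b) ≠ 0 := by linarith
  have hbs : b * s = s - 1 := by linear_combination -hs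
  have has : a * s = μ := by rw [← hμ]; linear_combination μ * hs
  have r1 : S 1 = μ := by
    rw [hS0] at q1
    linear_combination s * q1 - S 1 * hs + has
  have r2 : S 2 = μ ^ 2 + s * μ := by
    rw [hS0, r1] at q2
    linear_combination s * q2 - S 2 * hs + (μ + 1) * has + μ * hbs
  have r3 : S 3 = μ ^ 3 + 3 * s * μ ^ 2 + (2 * s ^ 2 - s) * μ := by
    rw [hS0, r1, r2] at q3
    linear_combination s * q3 - S 3 * hs + (μ ^ 2 + s * μ + (2 * μ + 1)) * has +
      (2 * (μ ^ 2 + s * μ) + μ) * hbs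
  have r4 : S 4 = μ ^ 4 + 6 * s * μ ^ 3 + (11 * s ^ 2 - 4 * s) * μ ^ 2 +
      (6 * s ^ 3 - 6 * s ^ 2 + s) * μ := by
    rw [hS0, r1, r2, r3] at q4
    linear_combination s * q4 - S 4 * hs + (μ ^ 3 + 3 * s * μ ^ 2 + (2 * s ^ 2 - s) * μ +
      (3 * (μ ^ 2 + s * μ) + (3 * μ + 1))) * has + (3 * (μ ^ 3 + 3 * s * μ ^ 2 +
      (2 * s ^ 2 - s) * μ) + (3 * (μ ^ 2 + s * μ) + μ)) * hbs
  have hmap : ∀ j : ℕ, ∫ x, x ^ j ∂(ν.map (Nat.cast : ℕ → ℝ)) = S j := fun j =>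
    integral_map hcast.aemeasurable (by fun_prop)
  refine ⟨fun k hk => ?_, ?_, ?_, ?_, ?_⟩
  · rw [integrable_map_measure (by fun_prop) hcast.aemeasurable]
    exact hint k hk
  · rw [hmap, r1]
  · rw [hmap, r2]
  · rw [hmap, r3]
  · rw [hmap, r4]

theorem rawMoments_poisson {r : ℝ} (hr : 0 < r) :
    RawMoments ((poissonMeasure r.toNNReal).map (Nat.cast : ℕ → ℝ)) r (r ^ 2 + 1 * r)
      (r ^ 3 + 3 * 1 * r ^ 2 + (2 * 1 ^ 2 - 1) * r)
      (r ^ 4 + 6 * 1 * r ^ 3 + (11 * 1 ^ 2 - 4 * 1) * r ^ 2 +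
        (6 * 1 ^ 3 - 6 * 1 ^ 2 + 1) * r) := by
  refine rawMoments_of_panjer (m := fun k => Real.exp (-r) * r ^ k / (k.factorial : ℝ)) (a := r)
    (b := 0) (fun k => by positivity) le_rfl one_pos hr ?_ (by ring) (by ring) ?_
  · intro k
    rw [Nat.factorial_succ]
    push_cast
    have : (k.factorial : ℝ) ≠ 0 := by positivity
    field_simp
    ring
  · simp only [poissonMeasure, Real.coe_toNNReal _ hr.le]

theorem rawMoments_negBinomial {n q θ : ℝ} (hn : 0 < n) (hq0 : 0 < q) (hq1 : q < 1)
    (hθ : θ = q / (1 - q)) [IsProbabilityMeasure (negBinomialMeasure n q)] :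
    RawMoments ((negBinomialMeasure n q).map (Nat.cast : ℕ → ℝ)) (n * θ)
      ((n * θ) ^ 2 + (1 + θ) * (n * θ))
      ((n * θ) ^ 3 + 3 * (1 + θ) * (n * θ) ^ 2 + (2 * (1 + θ) ^ 2 - (1 + θ)) * (n * θ))
      ((n * θ) ^ 4 + 6 * (1 + θ) * (n * θ) ^ 3 +
        (11 * (1 + θ) ^ 2 - 4 * (1 + θ)) * (n * θ) ^ 2 +
        (6 * (1 + θ) ^ 3 - 6 * (1 + θ) ^ 2 + (1 + θ)) * (n * θ)) := by
  have h1 : 0 < 1 - q := by linarith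
  have h2 : θ * (1 - q) = q := by rw [hθ, div_mul_cancel₀ _ h1.ne']
  refine rawMoments_of_panjer (m := fun k => (ascPochhammer ℝ k).eval n / (k.factorial : ℝ) *
    q ^ k * (1 - q) ^ n) (a := n * q) (b := q) (fun k => ?_) hq0.le hq1 (by positivity) ?_
    (by linear_combination n * h2) (by linear_combination h2) rfl
  · have := ascPochhammer_pos k n hn
    have := Real.rpow_pos_of_pos h1 n
    positivity
  · intro k
    rw [Nat.factorial_succ, ascPochhammer_succ_eval]
    push_cast
    have : (k.factorial : ℝ) ≠ 0 := by positivity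
    field_simp
    ring

/-- Moments of a distribution given by a density. -/
theorem rawMoments_withDensity {f : ℝ → ℝ} (hf : Measurable f) (hf0 : ∀ x, 0 ≤ f x)
    {m₁ m₂ m₃ m₄ : ℝ} (hi : ∀ k ≤ 4, Integrable fun x => f x * x ^ k)
    (h1 : ∫ x, f x * x ^ 1 = m₁) (h2 : ∫ x, f x * x ^ 2 = m₂) (h3 : ∫ x, f x * x ^ 3 = m₃)
    (h4 : ∫ x, f x * x ^ 4 = m₄) :
    RawMoments (volume.withDensity fun x => ENNReal.ofReal (f x)) m₁ m₂ m₃ m₄ := by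
  have hm : Measurable fun x => ENNReal.ofReal (f x) := hf.ennreal_ofReal
  have ht : ∀ᵐ x, ENNReal.ofReal (f x) < ⊤ := ae_of_all _ fun x => ENNReal.ofReal_lt_top
  have hint : ∀ k : ℕ, ∫ x, x ^ k ∂(volume.withDensity fun x => ENNReal.ofReal (f x)) =
      ∫ x, f x * x ^ k := by
    intro k
    rw [integral_withDensity_eq_integral_toReal_smul hm ht]
    simp only [ENNReal.toReal_ofReal (hf0 _), smul_eq_mul]
  refine ⟨fun k hk => ?_, (hint 1).trans h1, (hint 2).trans h2, (hint 3).trans h3,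
    (hint 4).trans h4⟩
  rw [integrable_withDensity_iff_integrable_smul' hm ht]
  simp only [ENNReal.toReal_ofReal (hf0 _), smul_eq_mul]
  exact hi k hk

theorem gammaPDFReal_mul_self {a r : ℝ} (ha : 0 < a) (hr : 0 < r) (x : ℝ) :
    gammaPDFReal a r x * x = a / r * gammaPDFReal (a + 1) r x := by
  unfold gammaPDFReal
  split_ifs with hx
  · have hG : Real.Gamma a ≠ 0 := (Real.Gamma_pos_of_pos ha).ne'
    rw [Real.Gamma_add_one ha.ne', Real.rpow_add_one hr.ne']
    rcases hx.eq_or_lt with rfl | hx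
    · simp [Real.zero_rpow ha.ne']
    · have e : x ^ (a + 1 - 1) = x ^ (a - 1) * x := by
        rw [← Real.rpow_add_one hx.ne']
        congr 1
        ring
      rw [e]
      field_simp
  · simp

theorem integrable_gammaPDFReal {a r : ℝ} (ha : 0 < a) (hr : 0 < r) :
    Integrable (gammaPDFReal a r) ∧ ∫ x, gammaPDFReal a r x = 1 := by
  have h0 : 0 ≤ᵐ[volume] gammaPDFReal a r := ae_of_all _ fun x => gammaPDFReal_nonneg ha hr x
  have h1 := lintegral_gammaPDF_eq_one ha hr
  unfold gammaPDF at h1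
  have hm := (stronglyMeasurable_gammaPDFReal a r).aestronglyMeasurable (μ := volume)
  refine ⟨⟨hm, ?_⟩, ?_⟩
  · rw [hasFiniteIntegral_iff_ofReal h0, h1]
    exact ENNReal.one_lt_top
  · rw [integral_eq_lintegral_of_nonneg_ae h0 hm, h1, ENNReal.toReal_one]

theorem rawMoments_gamma {a l : ℝ} (ha : 0 < a) (hl : 0 < l) :
    RawMoments (gammaMeasure a l⁻¹) (a * l) (a * (a + 1) * l ^ 2)
      (a * (a + 1) * (a + 2) * l ^ 3) (a * (a + 1) * (a + 2) * (a + 3) * l ^ 4) := by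
  have hr : 0 < l⁻¹ := inv_pos.2 hl
  have s : ∀ b x, 0 < b → gammaPDFReal b l⁻¹ x * x = b * l * gammaPDFReal (b + 1) l⁻¹ x := by
    intro b x hb
    rw [gammaPDFReal_mul_self hb hr, div_inv_eq_mul]
  have e1 : ∀ x, gammaPDFReal a l⁻¹ x * x ^ 1 = a * l * gammaPDFReal (a + 1) l⁻¹ x := by
    intro x
    rw [pow_one, s a x ha]
  have e2 : ∀ x, gammaPDFReal a l⁻¹ x * x ^ 2 =
      a * (a + 1) * l ^ 2 * gammaPDFReal (a + 1 + 1) l⁻¹ x := by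
    intro x
    rw [pow_succ, ← mul_assoc, e1, mul_assoc, s _ x (by positivity)]
    ring
  have e3 : ∀ x, gammaPDFReal a l⁻¹ x * x ^ 3 =
      a * (a + 1) * (a + 2) * l ^ 3 * gammaPDFReal (a + 1 + 1 + 1) l⁻¹ x := by
    intro x
    rw [pow_succ, ← mul_assoc, e2, mul_assoc, s _ x (by positivity)]
    ring
  have e4 : ∀ x, gammaPDFReal a l⁻¹ x * x ^ 4 =
      a * (a + 1) * (a + 2) * (a + 3) * l ^ 4 * gammaPDFReal (a + 1 + 1 + 1 + 1) l⁻¹ x := by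
    intro x
    rw [pow_succ, ← mul_assoc, e3, mul_assoc, s _ x (by positivity)]
    ring
  have I : ∀ b, 0 < b → Integrable (gammaPDFReal b l⁻¹) := fun b hb =>
    (integrable_gammaPDFReal hb hr).1
  have J : ∀ b, 0 < b → ∫ x, gammaPDFReal b l⁻¹ x = 1 := fun b hb =>
    (integrable_gammaPDFReal hb hr).2
  refine rawMoments_withDensity (measurable_gammaPDFReal a l⁻¹)
    (fun x => gammaPDFReal_nonneg ha hr x) ?_ ?_ ?_ ?_ ?_
  · intro k hk
    interval_cases k
    · simpa using I a ha
    · simp only [e1]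
      exact (I _ (by positivity)).const_mul _
    · simp only [e2]
      exact (I _ (by positivity)).const_mul _
    · simp only [e3]
      exact (I _ (by positivity)).const_mul _
    · simp only [e4]
      exact (I _ (by positivity)).const_mul _
  · simp only [e1]
    rw [integral_const_mul, J _ (by positivity), mul_one]
  · simp only [e2]
    rw [integral_const_mul, J _ (by positivity), mul_one]
  · simp only [e3]
    rw [integral_const_mul, J _ (by positivity), mul_one]
  · simp only [e4]
    rw [integral_const_mul, J _ (by positivity), mul_one]

theorem fourthMomentBounds_binomial {n : ℕ} (hn : 1 ≤ n) (q : unitInterval) :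
    FourthMomentBounds (((binomial n q).map (Nat.cast : ℕ → ℝ)).map fun x => x / (n : ℝ))
      (fun x => x) q ((q * (1 - q) : ℝ) / n) 1 := by
  have hn0 : (0 : ℝ) < n := by exact_mod_cast hn
  have hmap : ((binomial n q).map (Nat.cast : ℕ → ℝ)).map (fun x => x / (n : ℝ)) =
      (binomial n q).map fun k : ℕ => (k : ℝ) / n :=
    Measure.map_map (by fun_prop) (by fun_prop)
  rw [hmap]
  have hm : AEMeasurable (fun k : ℕ => (k : ℝ) / n) (binomial n q) := by fun_prop
  have hq0 : (0 : ℝ) ≤ q := q.2.1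
  have hq1 : (q : ℝ) ≤ 1 := q.2.2
  set w : ℕ → ℝ := fun k => n.choose k * (q : ℝ) ^ k * (1 - q) ^ (n - k) with hw
  have hI : ∀ f : ℝ → ℝ, Continuous f →
      ∫ x, f x ∂((binomial n q).map fun k : ℕ => (k : ℝ) / n) =
        ∑ k ∈ Finset.range (n + 1), w k * f (k / n) := by
    intro f hf
    rw [integral_map hm hf.aestronglyMeasurable, integral_binomial]
    rw [show Finset.Iic n = Finset.range (n + 1) by ext; simp]
    simp [hw]
  have hb : ∀ k, (bernsteinPolynomial ℝ n k).eval (q : ℝ) = w k := by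
    intro k
    simp [bernsteinPolynomial, hw]
  have h0 : ∑ k ∈ Finset.range (n + 1), w k = 1 := by
    have := congrArg (Polynomial.eval (q : ℝ)) (bernsteinPolynomial.sum ℝ n)
    simpa [Polynomial.eval_finsetSum, hb] using this
  have h1 : ∑ k ∈ Finset.range (n + 1), (k : ℝ) * w k = n * q := by
    have := congrArg (Polynomial.eval (q : ℝ)) (bernsteinPolynomial.sum_smul ℝ n)
    simpa [Polynomial.eval_finsetSum, hb] using this
  have h2 : ∑ k ∈ Finset.range (n + 1), (n * (q : ℝ) - k) ^ 2 * w k = n * q * (1 - q) := by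
    have := congrArg (Polynomial.eval (q : ℝ)) (bernsteinPolynomial.variance ℝ n)
    simpa [Polynomial.eval_finsetSum, hb] using this
  refine ⟨aemeasurable_id, ?_, ?_, ?_, ?_, ?_, ?_⟩
  · rw [integrable_map_measure (by fun_prop) hm]
    exact integrable_binomial _
  · rw [hI (fun x => x) continuous_id]
    have e : ∀ k : ℕ, w k * ((k : ℝ) / n) = (k : ℝ) * w k / n := fun k => by ring
    simp only [e]
    rw [← Finset.sum_div, h1]
    field_simp
  · rw [hI (fun x => (x - q) ^ 2) (by fun_prop)]
    have e : ∀ k : ℕ, w k * ((k : ℝ) / n - q) ^ 2 = (n * (q : ℝ) - k) ^ 2 * w k / n ^ 2 := by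
      intro k
      field_simp
      ring
    simp only [e]
    rw [← Finset.sum_div, h2]
    field_simp
  · rw [hI (fun x => (x - q) ^ 4) (by fun_prop), ← h0]
    refine Finset.sum_le_sum fun k hk => ?_
    have hk' : (k : ℝ) ≤ n := by exact_mod_cast Nat.lt_succ_iff.1 (Finset.mem_range.1 hk)
    have hw0 : 0 ≤ w k := by
      have : 0 ≤ 1 - (q : ℝ) := by linarith
      positivity
    refine mul_le_of_le_one_right hw0 ?_
    have a1 : 0 ≤ (k : ℝ) / n := by positivity
    have a2 : (k : ℝ) / n ≤ 1 := (div_le_one hn0).2 hk'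
    have a3 : ((k : ℝ) / n - q) ^ 2 ≤ 1 := by
      rw [sq_le_one_iff_abs_le_one, abs_le]
      constructor <;> linarith
    have e : ((k : ℝ) / n - q) ^ 4 = (((k : ℝ) / n - q) ^ 2) ^ 2 := by ring
    rw [e]
    exact pow_le_one₀ (sq_nonneg _) a3
  · have a1 : (q : ℝ) * (1 - q) ≤ 1 := by nlinarith
    have a2 : ((q : ℝ) * (1 - q)) / n ≤ 1 :=
      (div_le_one hn0).2 (a1.trans (by exact_mod_cast hn))
    have a3 : (q : ℝ) ^ 2 ≤ 1 := pow_le_one₀ hq0 hq1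
    nlinarith [sq_nonneg (q : ℝ)]
  · exact pow_le_one₀ hq0 hq1

open Complex in
/-- Along vertical lines, `‖Γ(a + i b)‖ / Γ(a)` increases with `a`. -/
theorem norm_Gamma_mul_Gamma_le {a A b : ℝ} (ha : 0 < a) (hA : a < A) :
    ‖Complex.Gamma (a + b * I)‖ * Real.Gamma A ≤ Real.Gamma a * ‖Complex.Gamma (A + b * I)‖ := by
  set t : ℝ := A - a with ht
  have ht0 : 0 < t := by simp only [t]; linarith
  have h1 : Complex.Gamma (a + b * I) * Complex.Gamma t =
      Complex.Gamma (A + b * I) * betaIntegral (a + b * I) t := by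
    rw [Gamma_mul_Gamma_eq_betaIntegral (by simpa using ha) (by simpa using ht0)]
    congr 2
    simp only [t]
    push_cast
    ring
  have h2 : Complex.Gamma a * Complex.Gamma t = Complex.Gamma A * betaIntegral a t := by
    rw [Gamma_mul_Gamma_eq_betaIntegral (by simpa using ha) (by simpa using ht0)]
    congr 2
    simp only [t]
    push_cast
    ring
  set R : ℝ := ∫ x in (0 : ℝ)..1, ‖(x : ℂ) ^ ((a + b * I : ℂ) - 1) * (1 - (x : ℂ)) ^ ((t : ℂ) - 1)‖
    with hR
  have h3 : betaIntegral a t = R := by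
    rw [betaIntegral, hR, ← intervalIntegral.integral_ofReal]
    refine intervalIntegral.integral_congr_ae ?_
    have hne : ∀ᵐ x : ℝ, x ≠ 1 := by simp [ae_iff]
    filter_upwards [hne] with x hx1 hx
    rw [Set.uIoc_of_le zero_le_one] at hx
    have hx0 : 0 < x := hx.1
    have hx2 : 0 < 1 - x := sub_pos.2 (lt_of_le_of_ne hx.2 hx1)
    have e1 : (1 - (x : ℂ)) = ((1 - x : ℝ) : ℂ) := by push_cast; ring
    rw [norm_mul, e1, norm_cpow_eq_rpow_re_of_pos hx0, norm_cpow_eq_rpow_re_of_pos hx2]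
    simp only [sub_re, add_re, ofReal_re, mul_re, I_re, mul_zero, ofReal_im, I_im, mul_one,
      sub_self, add_zero, one_re]
    rw [ofReal_mul, ofReal_cpow hx0.le, ofReal_cpow hx2.le]
    push_cast
    rfl
  have h4 : ‖betaIntegral (a + b * I) t‖ ≤ R :=
    intervalIntegral.norm_integral_le_integral_norm zero_le_one
  have h5 : Real.Gamma a * Real.Gamma t = Real.Gamma A * R := by
    rw [h3] at h2
    simp only [Complex.Gamma_ofReal] at h2
    exact_mod_cast h2
  have h6 := congrArg norm h1
  have hGt := Real.Gamma_pos_of_pos ht0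
  have hGA := Real.Gamma_pos_of_pos (ha.trans hA)
  rw [norm_mul, norm_mul, Complex.Gamma_ofReal, Complex.norm_real,
    Real.norm_of_nonneg hGt.le] at h6
  refine le_of_mul_le_mul_right ?_ hGt
  calc ‖Complex.Gamma (a + b * I)‖ * Real.Gamma A * Real.Gamma t
      = Real.Gamma A * (‖Complex.Gamma (a + b * I)‖ * Real.Gamma t) := by ring
    _ = Real.Gamma A * (‖Complex.Gamma (A + b * I)‖ * ‖betaIntegral (a + b * I) t‖) := by rw [h6]
    _ ≤ Real.Gamma A * (‖Complex.Gamma (A + b * I)‖ * R) := by gcongr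
    _ = (Real.Gamma A * R) * ‖Complex.Gamma (A + b * I)‖ := by ring
    _ = Real.Gamma a * ‖Complex.Gamma (A + b * I)‖ * Real.Gamma t := by rw [← h5]; ring

open Complex in
theorem norm_Gamma_half_sq (b : ℝ) :
    ‖Complex.Gamma (1 / 2 + b * I)‖ ^ 2 = Real.pi / Real.cosh (Real.pi * b) := by
  have h := Complex.Gamma_mul_Gamma_one_sub (1 / 2 + b * I)
  have e1 : (1 : ℂ) - (1 / 2 + b * I) = (starRingEnd ℂ) (1 / 2 + b * I) := by
    simp only [map_add, map_div₀, map_one, map_ofNat, map_mul, conj_ofReal, conj_I]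
    ring
  have e2 : Complex.sin (Real.pi * (1 / 2 + b * I)) = (Real.cosh (Real.pi * b) : ℝ) := by
    have : (Real.pi : ℂ) * (1 / 2 + b * I) = ((Real.pi * b : ℝ) : ℂ) * I + Real.pi / 2 := by
      push_cast
      ring
    rw [this, Complex.sin_add_pi_div_two, Complex.cos_mul_I]
    exact (Complex.ofReal_cosh _).symm
  rw [e1, Complex.Gamma_conj, Complex.mul_conj, e2, Complex.normSq_eq_norm_sq] at h
  exact_mod_cast h

open Complex in
theorem norm_Gamma_nat_add_half_le (N : ℕ) (b : ℝ) :
    ‖Complex.Gamma ((N + 1 / 2 : ℝ) + b * I)‖ ≤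
      (N + 1 + |b|) ^ N * ‖Complex.Gamma (1 / 2 + b * I)‖ := by
  induction N with
  | zero => simp
  | succ N ih =>
    have hz : ((N + 1 / 2 : ℝ) : ℂ) + b * I ≠ 0 := by
      intro h0
      have := congrArg Complex.re h0
      simp only [add_re, ofReal_re, mul_re, I_re, mul_zero, ofReal_im, I_im, mul_one, sub_self,
        add_zero, zero_re] at this
      have hN : (0 : ℝ) ≤ N := by positivity
      linarith
    have e : (((N + 1 : ℕ) + 1 / 2 : ℝ) : ℂ) + b * I = (((N + 1 / 2 : ℝ) : ℂ) + b * I) + 1 := by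
      push_cast
      ring
    rw [e, Complex.Gamma_add_one _ hz, norm_mul]
    have h1 : ‖((N + 1 / 2 : ℝ) : ℂ) + b * I‖ ≤ N + 1 + 1 + |b| := by
      refine (norm_add_le _ _).trans ?_
      rw [norm_mul, norm_I, Complex.norm_real, Complex.norm_real, Real.norm_eq_abs,
        Real.norm_eq_abs, abs_of_nonneg (by positivity : (0 : ℝ) ≤ N + 1 / 2)]
      linarith
    have h2 : ((N : ℝ) + 1 + |b|) ^ N ≤ (N + 1 + 1 + |b|) ^ N := by
      refine pow_le_pow_left₀ (by positivity) ?_ N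
      linarith
    rw [Nat.cast_add_one]
    calc _ ≤ ((N : ℝ) + 1 + 1 + |b|) * ((N + 1 + |b|) ^ N * ‖Complex.Gamma (1 / 2 + b * I)‖) := by
            gcongr
      _ ≤ ((N : ℝ) + 1 + 1 + |b|) * ((N + 1 + 1 + |b|) ^ N *
            ‖Complex.Gamma (1 / 2 + b * I)‖) := by gcongr
      _ = _ := by ring

/-- A power is absorbed by an exponential. -/
theorem exists_pow_mul_exp_le (K δ : ℝ) (hK : 0 ≤ K) (hδ : 0 < δ) (M : ℕ) :
    ∃ C, 0 ≤ C ∧ ∀ u : ℝ, 0 ≤ u →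
      (K + u) ^ M * Real.exp (-(δ * u)) ≤ C * Real.exp (-(δ / 2 * u)) := by
  refine ⟨(2 / δ) ^ M * M.factorial * Real.exp (δ / 2 * K), by positivity, fun u hu => ?_⟩
  have h1 := Real.pow_div_factorial_le_exp (δ / 2 * (K + u)) (by positivity) M
  rw [div_le_iff₀ (by positivity)] at h1
  have h2 : (K + u) ^ M = (2 / δ) ^ M * (δ / 2 * (K + u)) ^ M := by
    rw [← mul_pow]
    congr 1
    field_simp
  calc (K + u) ^ M * Real.exp (-(δ * u))
      ≤ (2 / δ) ^ M * (Real.exp (δ / 2 * (K + u)) * M.factorial) * Real.exp (-(δ * u)) := by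
        rw [h2]
        gcongr
    _ = (2 / δ) ^ M * M.factorial * (Real.exp (δ / 2 * (K + u)) * Real.exp (-(δ * u))) := by ring
    _ = (2 / δ) ^ M * M.factorial * (Real.exp (δ / 2 * K) * Real.exp (-(δ / 2 * u))) := by
        rw [← Real.exp_add, ← Real.exp_add]
        congr 2
        ring
    _ = _ := by ring

open Complex in
/-- Exponential decay of products of Gamma functions, uniformly in the real parts. -/
theorem exists_Gamma_mul_Gamma_bound {a₀ φ : ℝ} (ha₀ : 0 < a₀) (hφ : |φ| < Real.pi / 2) (k : ℕ) :
    ∃ C δ : ℝ, 0 ≤ C ∧ 0 < δ ∧ ∀ a₁ ∈ Set.Icc a₀ (a₀ + 1), ∀ a₂ ∈ Set.Icc a₀ (a₀ + 1), ∀ x : ℝ,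
      ‖Complex.Gamma (a₁ + (x / 2 : ℝ) * I)‖ * ‖Complex.Gamma (a₂ + (-(x / 2) : ℝ) * I)‖ *
        Real.exp (φ * x) * (1 + |x|) ^ k ≤ C * Real.exp (-(δ * |x|)) := by
  obtain ⟨N, hN⟩ := exists_nat_gt (a₀ + 1)
  set A : ℝ := N + 1 / 2 with hA
  have hA0 : 0 < A := by positivity
  have hGA := Real.Gamma_pos_of_pos hA0
  obtain ⟨D, hD⟩ := (isCompact_Icc (a := a₀) (b := a₀ + 1)).exists_bound_of_continuousOn
    (f := Real.Gamma) (fun a ha => by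
      refine (Real.differentiableAt_Gamma fun m => ?_).continuousAt.continuousWithinAt
      have h1 := ha.1
      have h2 : (0 : ℝ) ≤ m := by positivity
      linarith)
  have hD0 : 0 ≤ D := (norm_nonneg _).trans (hD a₀ ⟨le_rfl, by linarith⟩)
  set K : ℝ := N + 1 with hK
  have hG : ∀ a ∈ Set.Icc a₀ (a₀ + 1), ∀ b : ℝ, ‖Complex.Gamma (a + b * I)‖ ≤
      D / Real.Gamma A * ((K + |b|) ^ N * ‖Complex.Gamma (1 / 2 + b * I)‖) := by
    intro a ha b
    have h1 := norm_Gamma_mul_Gamma_le (A := A) (b := b) (ha₀.trans_le ha.1)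
      (by rw [hA]; linarith [ha.2])
    have h2 := norm_Gamma_nat_add_half_le N b
    have h3 : Real.Gamma a ≤ D := (le_abs_self _).trans (hD a ha)
    rw [div_mul_eq_mul_div, le_div_iff₀ hGA]
    refine h1.trans ?_
    gcongr
  have hhalf : ∀ x : ℝ, ‖Complex.Gamma (1 / 2 + (x / 2 : ℝ) * I)‖ *
      ‖Complex.Gamma (1 / 2 + (-(x / 2) : ℝ) * I)‖ ≤
        2 * Real.pi * Real.exp (-(Real.pi / 2 * |x|)) := by
    intro x
    have e : ‖Complex.Gamma (1 / 2 + (-(x / 2) : ℝ) * I)‖ =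
        ‖Complex.Gamma (1 / 2 + (x / 2 : ℝ) * I)‖ := by
      rw [← Complex.norm_conj, ← Complex.Gamma_conj]
      congr 2
      simp only [map_add, map_div₀, map_one, map_ofNat, map_mul, conj_ofReal, conj_I]
      push_cast
      ring
    rw [e, ← sq, norm_Gamma_half_sq]
    have h1 : Real.exp (Real.pi / 2 * |x|) ≤ 2 * Real.cosh (Real.pi * (x / 2)) := by
      rw [← Real.cosh_abs, Real.cosh_eq]
      have e3 : |Real.pi * (x / 2)| = Real.pi / 2 * |x| := by
        rw [abs_mul, abs_div, abs_of_pos Real.pi_pos, abs_two]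
        ring
      rw [e3]
      have := Real.exp_pos (-(Real.pi / 2 * |x|))
      linarith
    rw [Real.exp_neg, div_le_iff₀ (Real.cosh_pos _)]
    have h2 := Real.exp_pos (Real.pi / 2 * |x|)
    have h4 : 1 ≤ (Real.exp (Real.pi / 2 * |x|))⁻¹ * (2 * Real.cosh (Real.pi * (x / 2))) := by
      rw [inv_mul_eq_div, le_div_iff₀ h2, one_mul]
      exact h1
    nlinarith [Real.pi_pos]
  set δ : ℝ := Real.pi / 2 - |φ| with hδ
  have hδ0 : 0 < δ := by rw [hδ]; linarith
  obtain ⟨C₁, hC₁, hpow⟩ := exists_pow_mul_exp_le K δ (by positivity) hδ0 (2 * N + k)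
  refine ⟨(D / Real.Gamma A) ^ 2 * (2 * Real.pi) * C₁, δ / 2, by positivity, by positivity, ?_⟩
  intro a₁ h₁ a₂ h₂ x
  have b1 := hG a₁ h₁ (x / 2)
  have b2 := hG a₂ h₂ (-(x / 2))
  have hx2 : |x / 2| ≤ |x| := by
    rw [abs_div, abs_two]
    linarith [abs_nonneg x]
  have p1 : (K + |x / 2|) ^ N ≤ (K + |x|) ^ N := pow_le_pow_left₀ (by positivity) (by linarith) N
  rw [abs_neg] at b2
  have hexp : Real.exp (φ * x) ≤ Real.exp (|φ| * |x|) := by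
    rw [← abs_mul]
    exact Real.exp_le_exp.2 (le_abs_self _)
  have p2 : (1 + |x|) ^ k ≤ (K + |x|) ^ k := by
    refine pow_le_pow_left₀ (by positivity) ?_ k
    have : (0 : ℝ) ≤ N := by positivity
    rw [hK]
    linarith
  set g₁ := ‖Complex.Gamma (1 / 2 + (x / 2 : ℝ) * I)‖
  set g₂ := ‖Complex.Gamma (1 / 2 + (-(x / 2) : ℝ) * I)‖
  have hDA : 0 ≤ D / Real.Gamma A := by positivity
  calc _ ≤ (D / Real.Gamma A * ((K + |x|) ^ N * g₁)) * (D / Real.Gamma A * ((K + |x|) ^ N * g₂)) *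
        Real.exp (|φ| * |x|) * (K + |x|) ^ k := by
        gcongr
        · exact b1.trans (by gcongr)
        · exact b2.trans (by gcongr)
    _ = (D / Real.Gamma A) ^ 2 * (g₁ * g₂) * Real.exp (|φ| * |x|) * (K + |x|) ^ (2 * N + k) := by
        ring
    _ ≤ (D / Real.Gamma A) ^ 2 * (2 * Real.pi * Real.exp (-(Real.pi / 2 * |x|))) *
        Real.exp (|φ| * |x|) * (K + |x|) ^ (2 * N + k) := by
        exact mul_le_mul_of_nonneg_right (mul_le_mul_of_nonneg_right
          (mul_le_mul_of_nonneg_left (hhalf x) (by positivity)) (by positivity)) (by positivity)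
    _ = (D / Real.Gamma A) ^ 2 * (2 * Real.pi) * ((K + |x|) ^ (2 * N + k) *
        (Real.exp (-(Real.pi / 2 * |x|)) * Real.exp (|φ| * |x|))) := by ring
    _ = (D / Real.Gamma A) ^ 2 * (2 * Real.pi) * ((K + |x|) ^ (2 * N + k) *
        Real.exp (-(δ * |x|))) := by
        rw [← Real.exp_add]
        congr 3
        rw [hδ]
        ring
    _ ≤ (D / Real.Gamma A) ^ 2 * (2 * Real.pi) * (C₁ * Real.exp (-(δ / 2 * |x|))) := by
        exact mul_le_mul_of_nonneg_left (hpow |x| (abs_nonneg x)) (by positivity)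
    _ = _ := by ring

theorem integrable_exp_neg_mul_abs {δ : ℝ} (hδ : 0 < δ) :
    Integrable fun x : ℝ => Real.exp (-(δ * |x|)) := by
  have h1 : IntegrableOn (fun x : ℝ => Real.exp (-(δ * |x|))) (Set.Ioi 0) := by
    refine (exp_neg_integrableOn_Ioi 0 hδ).congr_fun (fun x hx => ?_) measurableSet_Ioi
    simp only [abs_of_pos (Set.mem_Ioi.1 hx), neg_mul]
  have h2 : IntegrableOn (fun x : ℝ => Real.exp (-(δ * |x|))) (Set.Iic 0) := by
    rw [integrableOn_Iic_iff_integrableOn_Iio]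
    have := h1.comp_neg
    simpa using this
  rw [← integrableOn_univ, ← Set.Iic_union_Ioi (a := (0 : ℝ))]
  exact h2.union h1

open Complex in
/-- Shifting the line of integration across a horizontal strip. -/
theorem integral_shift_eq {G : ℂ → ℂ} {C δ : ℝ} (hδ : 0 < δ)
    (hG : DifferentiableOn ℂ G {z | |z.im| ≤ 1})
    (hb : ∀ x y : ℝ, |y| ≤ 1 → ‖G (x + y * I)‖ ≤ C * Real.exp (-(δ * |x|))) :
    Integrable (fun x : ℝ => G (x + I)) ∧ Integrable (fun x : ℝ => G (x - I)) ∧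
      ∫ x : ℝ, G (x + I) = ∫ x : ℝ, G (x - I) := by
  have hline : ∀ y : ℝ, |y| ≤ 1 → Integrable fun x : ℝ => G (x + y * I) := by
    intro y hy
    have hc : Continuous fun x : ℝ => G (x + y * I) := by
      refine hG.continuousOn.comp_continuous (by fun_prop) fun x => ?_
      simpa using hy
    exact ((integrable_exp_neg_mul_abs hδ).const_mul C).mono' hc.aestronglyMeasurable
      (ae_of_all _ fun x => hb x y hy)
  have i1 := hline 1 (by simp)
  have i2 := hline (-1) (by simp)
  have hrect : ∀ T : ℝ, (∫ x in -T..T, G (x + (-1 : ℝ) * I)) - (∫ x in -T..T, G (x + (1 : ℝ) * I)) +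
      I • (∫ y in (-1 : ℝ)..1, G (T + y * I)) - I • (∫ y in (-1 : ℝ)..1, G ((-T : ℝ) + y * I)) =
      0 := by
    intro T
    have h := integral_boundary_rect_eq_zero_of_differentiableOn G (-T - I) (T + I) (hG.mono ?_)
    · simpa using h
    · intro z hz
      have h2 := hz.2
      simp only [sub_im, neg_im, ofReal_im, I_im, add_im, zero_add, neg_zero, zero_sub,
        Set.mem_preimage] at h2
      rw [Set.uIcc_of_le (by norm_num)] at h2
      exact abs_le.2 h2
  have hexp : Tendsto (fun T : ℝ => C * Real.exp (-(δ * |T|)) * |(1 : ℝ) - -1|) atTop (𝓝 0) := by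
    have t1 : Tendsto (fun T : ℝ => δ * |T|) atTop atTop :=
      tendsto_abs_atTop_atTop.const_mul_atTop hδ
    have := ((Real.tendsto_exp_neg_atTop_nhds_zero.comp t1).const_mul C).mul_const |(1 : ℝ) - -1|
    simpa using this
  have hbd : ∀ y ∈ Set.uIoc (-1 : ℝ) 1, |y| ≤ 1 := by
    intro y hy
    rw [Set.uIoc_of_le (by norm_num)] at hy
    exact abs_le.2 ⟨hy.1.le, hy.2⟩
  have v1 : Tendsto (fun T : ℝ => ∫ y in (-1 : ℝ)..1, G (T + y * I)) atTop (𝓝 0) := by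
    refine squeeze_zero_norm (fun T => ?_) hexp
    exact intervalIntegral.norm_integral_le_of_norm_le_const fun y hy => hb T y (hbd y hy)
  have v2 : Tendsto (fun T : ℝ => ∫ y in (-1 : ℝ)..1, G ((-T : ℝ) + y * I)) atTop (𝓝 0) := by
    refine squeeze_zero_norm (fun T => ?_) hexp
    refine intervalIntegral.norm_integral_le_of_norm_le_const fun y hy => ?_
    have := hb (-T) y (hbd y hy)
    rwa [abs_neg] at this
  have l1 := intervalIntegral_tendsto_integral i1 tendsto_neg_atTop_atBot tendsto_id
  have l2 := intervalIntegral_tendsto_integral i2 tendsto_neg_atTop_atBot tendsto_id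
  have hlim := ((l2.sub l1).add (v1.const_smul I)).sub (v2.const_smul I)
  have h0 := tendsto_nhds_unique (tendsto_const_nhds.congr fun T => (hrect T).symm) hlim
  simp only [smul_zero, add_zero, sub_zero] at h0
  have e1 : ∀ x : ℝ, (x : ℂ) + (1 : ℝ) * I = x + I := fun x => by push_cast; ring
  have e2 : ∀ x : ℝ, (x : ℂ) + (-1 : ℝ) * I = x - I := fun x => by push_cast; ring
  simp only [e1] at i1 h0
  simp only [e2] at i2 h0
  exact ⟨i1, i2, (sub_eq_zero.1 h0.symm).symm⟩

/-- The GHS density up to its normalizing constant. -/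
noncomputable def ghsWeight (r φ x : ℝ) : ℝ :=
  ‖Complex.Gamma (((r : ℂ) + (x : ℂ) * Complex.I) / 2)‖ ^ 2 * Real.exp (φ * x)

open Complex in
theorem continuous_ghsWeight {r : ℝ} (hr : 0 < r) (φ : ℝ) : Continuous (ghsWeight r φ) := by
  have h : Continuous fun x : ℝ => Complex.Gamma (((r : ℂ) + (x : ℂ) * Complex.I) / 2) := by
    refine continuous_iff_continuousAt.2 fun x => ?_
    have h1 : ContinuousAt Complex.Gamma (((r : ℂ) + (x : ℂ) * Complex.I) / 2) := by
      refine (Complex.differentiableAt_Gamma _ fun m hm => ?_).continuousAt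
      have h2 := congrArg Complex.re hm
      have e : (((r : ℂ) + (x : ℂ) * Complex.I) / 2).re = r / 2 := by simp
      rw [e] at h2
      simp only [neg_re, natCast_re] at h2
      have : (0 : ℝ) ≤ m := by positivity
      linarith
    exact ContinuousAt.comp (f := fun x : ℝ => ((r : ℂ) + (x : ℂ) * Complex.I) / 2) h1
      (by fun_prop)
  unfold ghsWeight
  fun_prop

theorem ghsWeight_nonneg (r φ x : ℝ) : 0 ≤ ghsWeight r φ x := by
  unfold ghsWeight
  positivity

open Complex in
theorem integrable_ghsWeight_mul_pow {r φ : ℝ} (hr : 0 < r) (hφ : |φ| < Real.pi / 2) (k : ℕ) :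
    Integrable fun x => ghsWeight r φ x * x ^ k := by
  obtain ⟨C, δ, -, hδ, hb⟩ := exists_Gamma_mul_Gamma_bound (half_pos hr) hφ k
  refine ((integrable_exp_neg_mul_abs hδ).const_mul C).mono'
    ((continuous_ghsWeight hr φ).mul (continuous_pow k)).aestronglyMeasurable
    (ae_of_all _ fun x => ?_)
  refine le_trans ?_ (hb (r / 2) ⟨le_rfl, by linarith⟩ (r / 2) ⟨le_rfl, by linarith⟩ x)
  have e1 : ((r / 2 : ℝ) : ℂ) + (x / 2 : ℝ) * I = ((r : ℂ) + (x : ℂ) * I) / 2 := by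
    push_cast
    ring
  have e2 : ((r / 2 : ℝ) : ℂ) + (-(x / 2) : ℝ) * I =
      (starRingEnd ℂ) (((r : ℂ) + (x : ℂ) * I) / 2) := by
    simp only [map_add, map_div₀, map_ofNat, map_mul, conj_ofReal, conj_I]
    push_cast
    ring
  rw [e1, e2, Complex.Gamma_conj, Complex.norm_conj, norm_mul, norm_pow,
    Real.norm_of_nonneg (ghsWeight_nonneg _ _ _), Real.norm_eq_abs]
  unfold ghsWeight
  rw [sq]
  gcongr
  linarith [abs_nonneg x]

open Complex in
/-- The moment identities obtained from the functional equation of the Gamma function by shifting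
the line of integration. -/
theorem integral_ghsWeight_mul_im {r φ : ℝ} (hr : 0 < r) (hφ : |φ| < Real.pi / 2) (j : ℕ) :
    ∫ x : ℝ, ghsWeight r φ x *
      ((r - x * I) * (Real.cos φ + Real.sin φ * I) * (x + I) ^ j : ℂ).im = 0 := by
  set G : ℂ → ℂ := fun z => Complex.Gamma ((r + 1) / 2 + z / 2 * I) *
    Complex.Gamma ((r + 1) / 2 - z / 2 * I) * Complex.exp (φ * z) * z ^ j with hG
  have hdiff : DifferentiableOn ℂ G {z | |z.im| ≤ 1} := by
    intro z hz
    have hz' := abs_le.1 (show |z.im| ≤ 1 from hz)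
    have hg : ∀ w : ℂ, 0 < w.re → DifferentiableAt ℂ Complex.Gamma w := by
      intro w hw
      refine Complex.differentiableAt_Gamma _ fun m hm => ?_
      have h2 := congrArg Complex.re hm
      simp only [neg_re, natCast_re] at h2
      have : (0 : ℝ) ≤ m := by positivity
      linarith
    have g1 : DifferentiableAt ℂ Complex.Gamma ((r + 1) / 2 + z / 2 * I) := by
      refine hg _ ?_
      have e : ((r + 1) / 2 + z / 2 * I : ℂ).re = (r + 1) / 2 - z.im / 2 := by simp; ring
      rw [e]
      linarith [hz'.2]
    have g2 : DifferentiableAt ℂ Complex.Gamma ((r + 1) / 2 - z / 2 * I) := by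
      refine hg _ ?_
      have e : ((r + 1) / 2 - z / 2 * I : ℂ).re = (r + 1) / 2 + z.im / 2 := by simp
      rw [e]
      linarith [hz'.1]
    have k1 : DifferentiableAt ℂ (fun z : ℂ => Complex.Gamma ((r + 1) / 2 + z / 2 * I)) z :=
      DifferentiableAt.comp (g := Complex.Gamma) (f := fun z : ℂ => (r + 1) / 2 + z / 2 * I) z g1
        (by fun_prop)
    have k2 : DifferentiableAt ℂ (fun z : ℂ => Complex.Gamma ((r + 1) / 2 - z / 2 * I)) z :=
      DifferentiableAt.comp (g := Complex.Gamma) (f := fun z : ℂ => (r + 1) / 2 - z / 2 * I) z g2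
        (by fun_prop)
    exact (((k1.mul k2).mul (by fun_prop)).mul (by fun_prop)).differentiableWithinAt
  obtain ⟨C, δ, -, hδ, hb⟩ := exists_Gamma_mul_Gamma_bound (half_pos hr) hφ j
  have hbound : ∀ x y : ℝ, |y| ≤ 1 → ‖G (x + y * I)‖ ≤ C * Real.exp (-(δ * |x|)) := by
    intro x y hy
    have hy' := abs_le.1 hy
    refine le_trans ?_ (hb ((r + 1 - y) / 2) ⟨by linarith [hy'.2], by linarith [hy'.1]⟩
      ((r + 1 + y) / 2) ⟨by linarith [hy'.1], by linarith [hy'.2]⟩ x)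
    have e1 : ((r : ℂ) + 1) / 2 + (x + y * I) / 2 * I =
        ((r + 1 - y) / 2 : ℝ) + (x / 2 : ℝ) * I := by
      push_cast
      linear_combination (y / 2 : ℂ) * I_mul_I
    have e2 : ((r : ℂ) + 1) / 2 - (x + y * I) / 2 * I =
        ((r + 1 + y) / 2 : ℝ) + (-(x / 2) : ℝ) * I := by
      push_cast
      linear_combination (-y / 2 : ℂ) * I_mul_I
    simp only [hG]
    rw [e1, e2, norm_mul, norm_mul, norm_mul, norm_pow, Complex.norm_exp]
    have e3 : ((φ : ℂ) * (x + y * I)).re = φ * x := by simp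
    have e4 : ‖(x : ℂ) + y * I‖ ≤ 1 + |x| := by
      refine (norm_add_le _ _).trans ?_
      rw [norm_mul, norm_I, Complex.norm_real, Complex.norm_real, Real.norm_eq_abs,
        Real.norm_eq_abs]
      linarith
    rw [e3]
    gcongr
  obtain ⟨i1, i2, heq⟩ := integral_shift_eq hδ hdiff hbound
  set w : ℝ → ℂ := fun x => ((r : ℂ) + (x : ℂ) * I) / 2 with hw
  have hwre : ∀ x, (w x).re = r / 2 := fun x => by simp [hw]
  have hw0 : ∀ x, w x ≠ 0 := by
    intro x h0
    have h1 := congrArg Complex.re h0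
    rw [hwre, zero_re] at h1
    linarith
  have hconj : ∀ x, (starRingEnd ℂ) (w x) = ((r : ℂ) - (x : ℂ) * I) / 2 := by
    intro x
    simp only [hw, map_add, map_div₀, map_ofNat, map_mul, conj_ofReal, conj_I]
    ring
  have hGG : ∀ x, Complex.Gamma (w x) * Complex.Gamma ((starRingEnd ℂ) (w x)) =
      ((‖Complex.Gamma (w x)‖ ^ 2 : ℝ) : ℂ) := by
    intro x
    rw [Complex.Gamma_conj, Complex.mul_conj, Complex.normSq_eq_norm_sq]
  have hexp : ∀ x : ℝ, Complex.exp (φ * (x + I)) =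
      (Real.exp (φ * x) : ℝ) * (Real.cos φ + Real.sin φ * I) := by
    intro x
    rw [mul_add, Complex.exp_add, Complex.exp_mul_I]
    push_cast
    rfl
  have hexp' : ∀ x : ℝ, Complex.exp (φ * (x - I)) =
      (Real.exp (φ * x) : ℝ) * (Real.cos φ - Real.sin φ * I) := by
    intro x
    have e : (φ : ℂ) * (x - I) = φ * x + (-φ : ℝ) * I := by push_cast; ring
    rw [e, Complex.exp_add, Complex.exp_mul_I, ← Complex.ofReal_cos, ← Complex.ofReal_sin,
      Real.cos_neg, Real.sin_neg]
    push_cast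
    ring
  have hup : ∀ x : ℝ, G (x + I) = (ghsWeight r φ x / 2 : ℝ) *
      ((r - x * I) * (Real.cos φ + Real.sin φ * I) * (x + I) ^ j) := by
    intro x
    have e1 : ((r : ℂ) + 1) / 2 + (x + I) / 2 * I = w x := by
      simp only [hw]
      linear_combination (1 / 2 : ℂ) * I_mul_I
    have e2 : ((r : ℂ) + 1) / 2 - (x + I) / 2 * I = (starRingEnd ℂ) (w x) + 1 := by
      rw [hconj]
      linear_combination (-1 / 2 : ℂ) * I_mul_I
    simp only [hG]
    rw [e1, e2, Complex.Gamma_add_one _ ((map_ne_zero _).2 (hw0 x)), hexp]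
    unfold ghsWeight
    have h3 := hGG x
    rw [hconj] at h3 ⊢
    push_cast at h3 ⊢
    linear_combination ((r : ℂ) - x * I) / 2 * Complex.exp (φ * x) *
      (Complex.cos φ + Complex.sin φ * I) * (x + I) ^ j * h3
  have hdown : ∀ x : ℝ, G (x - I) = (starRingEnd ℂ) (G (x + I)) := by
    intro x
    have e1 : ((r : ℂ) + 1) / 2 + (x - I) / 2 * I = w x + 1 := by
      simp only [hw]
      linear_combination (-1 / 2 : ℂ) * I_mul_I
    have e2 : ((r : ℂ) + 1) / 2 - (x - I) / 2 * I = (starRingEnd ℂ) (w x) := by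
      rw [hconj]
      linear_combination (1 / 2 : ℂ) * I_mul_I
    rw [hup x]
    simp only [map_mul, map_sub, map_add, map_pow, conj_ofReal, conj_I]
    simp only [hG]
    rw [e1, e2, Complex.Gamma_add_one _ (hw0 x), hexp']
    unfold ghsWeight
    have h3 := hGG x
    rw [hconj] at h3 ⊢
    simp only [hw] at h3 ⊢
    push_cast at h3 ⊢
    linear_combination ((r : ℂ) + x * I) / 2 * Complex.exp (φ * x) *
      (Complex.cos φ - Complex.sin φ * I) * (x - I) ^ j * h3
  have him : ∫ x : ℝ, (G (x + I)).im = 0 := by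
    have h1 : ∫ x : ℝ, (G (x + I)).im = (∫ x : ℝ, G (x + I)).im :=
      Complex.imCLM.integral_comp_comm i1
    have h2 : ∫ x : ℝ, (G (x - I)).im = (∫ x : ℝ, G (x - I)).im :=
      Complex.imCLM.integral_comp_comm i2
    rw [← heq, ← h1] at h2
    simp only [hdown, Complex.conj_im] at h2
    rw [integral_neg] at h2
    linarith
  have hfin : ∀ x : ℝ, ghsWeight r φ x *
      ((r - x * I) * (Real.cos φ + Real.sin φ * I) * (x + I) ^ j : ℂ).im =
        2 * (G (x + I)).im := by
    intro x
    rw [hup x, Complex.im_ofReal_mul]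
    ring
  simp only [hfin]
  rw [integral_const_mul, him, mul_zero]

theorem rawMoments_ghs {r l : ℝ} (hr : 0 < r) [IsProbabilityMeasure (ghsMeasure r l)] :
    RawMoments (ghsMeasure r l) (r * l) (r * (r + 1) * l ^ 2 + r)
      (r * (r + 1) * (r + 2) * l ^ 3 + (3 * r ^ 2 + 2 * r) * l)
      (r * (r + 1) * (r + 2) * (r + 3) * l ^ 4 + (6 * r ^ 3 + 14 * r ^ 2 + 8 * r) * l ^ 2 +
        3 * r ^ 2 + 2 * r) := by
  set φ := Real.arctan l with hφdef
  have hφ : |φ| < Real.pi / 2 :=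
    abs_lt.2 ⟨Real.neg_pi_div_two_lt_arctan l, Real.arctan_lt_pi_div_two l⟩
  have hcos : 0 < Real.cos φ := Real.cos_arctan_pos l
  have hsin : Real.sin φ = l * Real.cos φ := by
    have := Real.tan_arctan l
    rw [Real.tan_eq_sin_div_cos, div_eq_iff hcos.ne'] at this
    exact this
  set c : ℝ := (1 + l ^ 2) ^ (-(r / 2)) * ((2 : ℝ) ^ (r - 2) / (Real.pi * Real.Gamma r)) with hc
  have hc0 : 0 ≤ c := by
    have := Real.Gamma_pos_of_pos hr
    have := Real.pi_pos
    positivity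
  have hpdf : ∀ x, ghsPDFReal r l x = c * ghsWeight r φ x := by
    intro x
    unfold ghsPDFReal ghsWeight
    rw [hc, mul_comm x (Real.arctan l)]
    ring
  have hmeas : Measurable (ghsPDFReal r l) := by
    have e : ghsPDFReal r l = fun x => c * ghsWeight r φ x := funext hpdf
    rw [e]
    exact ((continuous_ghsWeight hr φ).const_smul c).measurable
  have hnn : ∀ x, 0 ≤ ghsPDFReal r l x := fun x => by
    rw [hpdf]
    exact mul_nonneg hc0 (ghsWeight_nonneg _ _ _)
  set D : ℕ → ℝ := fun k => ∫ x, ghsWeight r φ x * x ^ k with hD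
  have hI : ∀ k : ℕ, Integrable fun x => ghsWeight r φ x * x ^ k :=
    integrable_ghsWeight_mul_pow hr hφ
  have hpI : ∀ k : ℕ, ∀ x, ghsPDFReal r l x * x ^ k = c * (ghsWeight r φ x * x ^ k) := by
    intro k x
    rw [hpdf]
    ring
  have hint : ∀ k : ℕ, ∫ x, ghsPDFReal r l x * x ^ k = c * D k := by
    intro k
    simp only [hpI]
    rw [integral_const_mul]
  have hD0 : c * D 0 = 1 := by
    have h1 : ∫ x, (1 : ℝ) ∂(ghsMeasure r l) = 1 := by simp
    unfold ghsMeasure at h1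
    rw [integral_withDensity_eq_integral_toReal_smul hmeas.ennreal_ofReal
      (ae_of_all _ fun x => ENNReal.ofReal_lt_top)] at h1
    simp only [ENNReal.toReal_ofReal (hnn _), smul_eq_mul] at h1
    rw [← hint 0]
    simpa using h1
  have key : ∀ a₀ a₁ a₂ a₃ a₄ : ℝ, ∫ x, (a₀ * (ghsWeight r φ x * x ^ 0) +
      (a₁ * (ghsWeight r φ x * x ^ 1) + (a₂ * (ghsWeight r φ x * x ^ 2) +
      (a₃ * (ghsWeight r φ x * x ^ 3) + a₄ * (ghsWeight r φ x * x ^ 4))))) =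
      a₀ * D 0 + (a₁ * D 1 + (a₂ * D 2 + (a₃ * D 3 + a₄ * D 4))) := by
    intro a₀ a₁ a₂ a₃ a₄
    have i0 := (hI 0).const_mul a₀
    have i1 := (hI 1).const_mul a₁
    have i2 := (hI 2).const_mul a₂
    have i3 := (hI 3).const_mul a₃
    have i4 := (hI 4).const_mul a₄
    refine (integral_add i0 (i1.add (i2.add (i3.add i4)))).trans ?_
    rw [integral_add' i1 (i2.add (i3.add i4)),
      integral_add' i2 (i3.add i4), integral_add' i3 i4]
    simp only [integral_const_mul, hD]
  have q1 : -Real.cos φ * D 1 + r * Real.sin φ * D 0 = 0 := by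
    have h := integral_ghsWeight_mul_im hr hφ 0
    have k := key (r * Real.sin φ) (-Real.cos φ) 0 0 0
    rw [integral_congr_ae (g := _) (ae_of_all _ fun x => ?_), h] at k
    · linarith
    · simp [-Complex.ofReal_cos, -Complex.ofReal_sin]
      ring
  have q2 : r * Real.cos φ * D 0 + (r + 1) * Real.sin φ * D 1 - Real.cos φ * D 2 = 0 := by
    have h := integral_ghsWeight_mul_im hr hφ 1
    have k := key (r * Real.cos φ) ((r + 1) * Real.sin φ) (-Real.cos φ) 0 0
    rw [integral_congr_ae (g := _) (ae_of_all _ fun x => ?_), h] at k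
    · linarith
    · simp [-Complex.ofReal_cos, -Complex.ofReal_sin]
      ring
  have q3 : -r * Real.sin φ * D 0 + (2 * r + 1) * Real.cos φ * D 1 +
      (r + 2) * Real.sin φ * D 2 - Real.cos φ * D 3 = 0 := by
    have h := integral_ghsWeight_mul_im hr hφ 2
    have k := key (-r * Real.sin φ) ((2 * r + 1) * Real.cos φ) ((r + 2) * Real.sin φ)
      (-Real.cos φ) 0
    rw [integral_congr_ae (g := _) (ae_of_all _ fun x => ?_), h] at k
    · linarith
    · simp [-Complex.ofReal_cos, -Complex.ofReal_sin, pow_succ]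
      ring
  have q4 : -r * Real.cos φ * D 0 - (3 * r + 1) * Real.sin φ * D 1 +
      (3 * r + 3) * Real.cos φ * D 2 + (r + 3) * Real.sin φ * D 3 - Real.cos φ * D 4 = 0 := by
    have h := integral_ghsWeight_mul_im hr hφ 3
    have k := key (-r * Real.cos φ) (-(3 * r + 1) * Real.sin φ) ((3 * r + 3) * Real.cos φ)
      ((r + 3) * Real.sin φ) (-Real.cos φ)
    rw [integral_congr_ae (g := _) (ae_of_all _ fun x => ?_), h] at k
    · linarith
    · simp [-Complex.ofReal_cos, -Complex.ofReal_sin, pow_succ]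
      ring
  rw [hsin] at q1 q2 q3 q4
  have m1 : c * D 1 = r * l := by
    refine mul_left_cancel₀ hcos.ne' ?_
    linear_combination -c * q1 + r * l * Real.cos φ * hD0
  have m2 : c * D 2 = r * (r + 1) * l ^ 2 + r := by
    refine mul_left_cancel₀ hcos.ne' ?_
    linear_combination -c * q2 + r * Real.cos φ * hD0 + (r + 1) * l * Real.cos φ * m1
  have m3 : c * D 3 = r * (r + 1) * (r + 2) * l ^ 3 + (3 * r ^ 2 + 2 * r) * l := by
    refine mul_left_cancel₀ hcos.ne' ?_
    linear_combination -c * q3 - r * l * Real.cos φ * hD0 + (2 * r + 1) * Real.cos φ * m1 +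
      (r + 2) * l * Real.cos φ * m2
  have m4 : c * D 4 = r * (r + 1) * (r + 2) * (r + 3) * l ^ 4 +
      (6 * r ^ 3 + 14 * r ^ 2 + 8 * r) * l ^ 2 + 3 * r ^ 2 + 2 * r := by
    refine mul_left_cancel₀ hcos.ne' ?_
    linear_combination -c * q4 - r * Real.cos φ * hD0 - (3 * r + 1) * l * Real.cos φ * m1 +
      (3 * r + 3) * Real.cos φ * m2 + (r + 3) * l * Real.cos φ * m3
  refine rawMoments_withDensity hmeas hnn (fun k _ => ?_) ((hint 1).trans m1)
    ((hint 2).trans m2) ((hint 3).trans m3) ((hint 4).trans m4)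
  simp only [hpI]
  exact (hI k).const_mul c

theorem isBigO_const_mul_one_add {w : ℕ → ℝ} (C : ℝ)
    (hw : (fun p : ℕ => ∑ i ∈ Finset.range p, w i) =O[atTop] (fun p : ℕ => (p : ℝ))) :
    (fun p : ℕ => ∑ i ∈ Finset.range p, C * (1 + w i)) =O[atTop] (fun p : ℕ => (p : ℝ)) := by
  have e : (fun p : ℕ => ∑ i ∈ Finset.range p, C * (1 + w i)) =
      fun p : ℕ => C * ((p : ℝ) + ∑ i ∈ Finset.range p, w i) := by
    funext p
    rw [← Finset.mul_sum, Finset.sum_add_distrib]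
    simp
  rw [e]
  exact ((isBigO_refl _ _).add hw).const_mul_left C

theorem sequenceBounds_conclusion {Ω : Type*} [MeasurableSpace Ω] {P : Measure Ω}
    [IsProbabilityMeasure P] {F : Family} {θ τ A : ℕ → ℝ} {Y : ℕ → Ω → ℝ} {c : ℝ}
    (hτ : ∀ i, 0 < τ i) (hd : ∀ i, 0 < τ i + F.nu2)
    (hc1 : ∀ i, |F.nu1 / (τ i + F.nu2)| ≤ c) (hc2 : ∀ i, |F.nu2 / (τ i + F.nu2)| ≤ c)
    (hindep : iIndepFun Y P) (hY : ∀ i, FourthMomentBounds P (Y i) (θ i) (F.V (θ i) / τ i) (A i))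
    (hA : (fun p : ℕ => ∑ i ∈ Finset.range p, A i) =O[atTop] (fun p : ℕ => (p : ℝ))) :
    (∀ p : ℕ, Integrable (fun ω => supDiscrepancy F p θ τ fun i => Y i ω) P) ∧
    Tendsto (fun p : ℕ => eLpNorm (fun ω => supDiscrepancy F p θ τ fun i => Y i ω) 1 P)
      atTop (𝓝 0) ∧
    TendstoInMeasure P (fun (p : ℕ) ω => supDiscrepancy F p θ τ fun i => Y i ω)
      atTop (fun _ => 0) := by
  have hest := fun i => (hY i).estimates (F := F) (c := max 1 c) (hτ i) (hd i) (le_max_left _ _)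
    ((hc1 i).trans (le_max_right _ _)) ((hc2 i).trans (le_max_right _ _))
  have hS : SequenceBounds P F θ τ (fun i => 60 * (max 1 c) ^ 2 * (1 + A i)) Y :=
    { nonneg := fun i => by
        have := (hY i).nonneg
        positivity
      aemeasurable := fun i => (hY i).aemeasurable
      indep := hindep
      varEst_sub := fun i => (hest i).1
      mul_sub_varEst := fun i => (hest i).2.1
      sub_mean := fun i => (hest i).2.2.1
      integrable_varEst := fun i => (hest i).2.2.2.1.1
      integral_varEst_le := fun i => (hest i).2.2.2.1.2
      integrable_sq := fun i => (hest i).2.2.2.2.1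
      integral_sq_le := fun i => (hest i).2.2.2.2.2 }
  exact hS.conclusion hτ (isBigO_const_mul_one_add _ hA)

theorem poisson_law_bounds {ξ τ Q : ℝ} (hτ : 0 < τ) (hξ : 0 < ξ) (hQ : 1 / τ ≤ Q) :
    FourthMomentBounds (Family.poisson.law ξ τ) (fun x => x) ξ (Family.poisson.V ξ / τ)
      ((3 * Q ^ 2 + Q ^ 3 + Q + 1) * (1 + ξ ^ 3)) := by
  have hq0 : 0 < 1 / τ := by positivity
  have hQ2 : (1 / τ) ^ 2 ≤ Q ^ 2 := pow_le_pow_left₀ hq0.le hQ 2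
  have hQ3 : (1 / τ) ^ 3 ≤ Q ^ 3 := pow_le_pow_left₀ hq0.le hQ 3
  have hQ0 : 0 < Q := hq0.trans_le hQ
  have hw1 : ξ ≤ 1 + ξ ^ 3 := by nlinarith [mul_nonneg hξ.le (sq_nonneg (ξ - 1)), sq_nonneg (ξ - 1)]
  have hw2 : ξ ^ 2 ≤ 1 + ξ ^ 3 := by
    nlinarith [mul_nonneg hξ.le (sq_nonneg (ξ - 1)), sq_nonneg (ξ - 1)]
  have hw3 : ξ ^ 3 ≤ 1 + ξ ^ 3 := by linarith
  have hw0 : 0 ≤ 1 + ξ ^ 3 := by positivity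
  refine (rawMoments_poisson (r := τ * ξ) (by positivity)).fourthMomentBounds (t := τ) ?_ ?_ ?_ ?_ ?_
  · field_simp
  · simp only [Family.V, Family.nu0, Family.nu1, Family.nu2]
    field_simp
    ring
  · have a1 := mul_le_mul hQ2 hw2 (by positivity) (by positivity)
    have a2 := mul_le_mul hQ3 hw1 (by positivity) (by positivity)
    refine le_trans (b := 3 * ((1 / τ) ^ 2 * ξ ^ 2) + (1 / τ) ^ 3 * ξ) (le_of_eq ?_) ?_
    · field_simp
      ring
    · nlinarith
  · simp only [Family.V, Family.nu0, Family.nu1, Family.nu2]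
    have a1 := mul_le_mul hQ hw3 (by positivity) (by positivity)
    refine le_trans (b := (1 / τ) * ξ ^ 3) (le_of_eq ?_) ?_
    · field_simp
      ring
    · have : 0 ≤ (3 * Q ^ 2 + Q ^ 3 + 1) * (1 + ξ ^ 3) := by positivity
      linarith
  · have : 0 ≤ (3 * Q ^ 2 + Q ^ 3 + Q) * (1 + ξ ^ 3) := by positivity
    linarith

theorem negBinomial_law_bounds {ξ τ Q : ℝ} (hτ : 0 < τ) (hξ0 : 0 < ξ) (hξ1 : ξ < 1)
    (hQ : 1 / τ ≤ Q) [IsProbabilityMeasure (Family.negBinomial.law ξ τ)] :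
    FourthMomentBounds (Family.negBinomial.law ξ τ) (fun x => x) (ξ / (1 - ξ))
      (Family.negBinomial.V (ξ / (1 - ξ)) / τ)
      ((12 * Q ^ 2 + 26 * Q ^ 3 + 2 * Q + 1) * (1 + (ξ / (1 - ξ)) ^ 4)) := by
  have hq0 : 0 < 1 / τ := by positivity
  have hQ2 : (1 / τ) ^ 2 ≤ Q ^ 2 := pow_le_pow_left₀ hq0.le hQ 2
  have hQ3 : (1 / τ) ^ 3 ≤ Q ^ 3 := pow_le_pow_left₀ hq0.le hQ 3
  have hQ0 : 0 < Q := hq0.trans_le hQ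
  have p0 : IsProbabilityMeasure
      (((negBinomialMeasure τ ξ).map (Nat.cast : ℕ → ℝ)).map fun x => x / τ) :=
    ‹IsProbabilityMeasure (Family.negBinomial.law ξ τ)›
  have p1 : IsProbabilityMeasure ((negBinomialMeasure τ ξ).map (Nat.cast : ℕ → ℝ)) :=
    Measure.isProbabilityMeasure_of_map fun x => x / τ
  have p2 : IsProbabilityMeasure (negBinomialMeasure τ ξ) :=
    Measure.isProbabilityMeasure_of_map (Nat.cast : ℕ → ℝ)
  set θ := ξ / (1 - ξ) with hθ
  have hθ0 : 0 < θ := div_pos hξ0 (by linarith)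
  have hw2 : θ ^ 2 ≤ 1 + θ ^ 4 := by nlinarith [sq_nonneg (θ ^ 2 - 1), sq_nonneg (θ ^ 2)]
  have hw1 : θ ≤ 1 + θ ^ 4 := by nlinarith [sq_nonneg (θ - 1), sq_nonneg (θ ^ 2 - 1)]
  have hw3 : θ ^ 3 ≤ 1 + θ ^ 4 := by
    nlinarith [mul_nonneg (sq_nonneg θ) (sq_nonneg (θ - 1)), sq_nonneg (θ ^ 2 - 1)]
  have hw4 : θ ^ 4 ≤ 1 + θ ^ 4 := by linarith
  have hw0 : 0 ≤ 1 + θ ^ 4 := by positivity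
  have hb1 : (θ + θ ^ 2) ^ 2 ≤ 4 * (1 + θ ^ 4) := by
    nlinarith
  have hb2 : (θ + θ ^ 2) * (1 + 6 * (θ + θ ^ 2)) ≤ 26 * (1 + θ ^ 4) := by nlinarith
  refine (rawMoments_negBinomial hτ hξ0 hξ1 hθ).fourthMomentBounds (t := τ) ?_ ?_ ?_ ?_ ?_
  · field_simp
  · simp only [Family.V, Family.nu0, Family.nu1, Family.nu2]
    field_simp
    ring
  · have a1 := mul_le_mul hQ2 hb1 (by positivity) (by positivity)
    have a2 := mul_le_mul hQ3 hb2 (by positivity) (by positivity)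
    refine le_trans (b := 3 * ((1 / τ) ^ 2 * (θ + θ ^ 2) ^ 2) +
      (1 / τ) ^ 3 * ((θ + θ ^ 2) * (1 + 6 * (θ + θ ^ 2)))) (le_of_eq ?_) ?_
    · field_simp
      ring
    · have : 0 ≤ (2 * Q + 1) * (1 + θ ^ 4) := by positivity
      linarith
  · simp only [Family.V, Family.nu0, Family.nu1, Family.nu2]
    have a1 := mul_le_mul hQ (show θ ^ 3 + θ ^ 4 ≤ 2 * (1 + θ ^ 4) by linarith) (by positivity)
      (by positivity)
    refine le_trans (b := (1 / τ) * (θ ^ 3 + θ ^ 4)) (le_of_eq ?_) ?_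
    · field_simp
      ring
    · have : 0 ≤ (12 * Q ^ 2 + 26 * Q ^ 3 + 1) * (1 + θ ^ 4) := by positivity
      linarith
  · have : 0 ≤ (12 * Q ^ 2 + 26 * Q ^ 3 + 2 * Q) * (1 + θ ^ 4) := by positivity
    linarith

theorem gamma_law_bounds {α l τ Q : ℝ} (hα : 0 < α) (hτ : 0 < τ) (hl : 0 < l) (hQ : 1 / τ ≤ Q) :
    FourthMomentBounds ((Family.gamma α).law l τ) (fun x => x) (α * l)
      ((Family.gamma α).V (α * l) / τ)
      ((3 * α ^ 2 * Q ^ 2 + 6 * α * Q ^ 3 + α ^ 3 * Q + α ^ 2) * (1 + l ^ 4)) := by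
  have hq0 : 0 < 1 / τ := by positivity
  have hQ2 : (1 / τ) ^ 2 ≤ Q ^ 2 := pow_le_pow_left₀ hq0.le hQ 2
  have hQ3 : (1 / τ) ^ 3 ≤ Q ^ 3 := pow_le_pow_left₀ hq0.le hQ 3
  have hQ0 : 0 < Q := hq0.trans_le hQ
  have hw2 : l ^ 2 ≤ 1 + l ^ 4 := by nlinarith [sq_nonneg (l ^ 2 - 1), sq_nonneg (l ^ 2)]
  have hw4 : l ^ 4 ≤ 1 + l ^ 4 := by linarith
  have hw0 : 0 ≤ 1 + l ^ 4 := by positivity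
  have ha : 0 < τ * α := by positivity
  have hprob := isProbabilityMeasure_gammaMeasure ha (inv_pos.2 hl)
  refine (rawMoments_gamma ha hl).fourthMomentBounds (t := τ) ?_ ?_ ?_ ?_ ?_
  · field_simp
  · simp only [Family.V, Family.nu0, Family.nu1, Family.nu2]
    field_simp
    ring
  · have a1 := mul_le_mul_of_nonneg_left (mul_le_mul hQ2 hw4 (by positivity) (by positivity))
      (by positivity : 0 ≤ 3 * α ^ 2)
    have a2 := mul_le_mul_of_nonneg_left (mul_le_mul hQ3 hw4 (by positivity) (by positivity))
      (by positivity : 0 ≤ 6 * α)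
    refine le_trans (b := 3 * α ^ 2 * ((1 / τ) ^ 2 * l ^ 4) + 6 * α * ((1 / τ) ^ 3 * l ^ 4))
      (le_of_eq ?_) ?_
    · field_simp
      ring
    · have : 0 ≤ (α ^ 3 * Q + α ^ 2) * (1 + l ^ 4) := by positivity
      linarith
  · simp only [Family.V, Family.nu0, Family.nu1, Family.nu2]
    have a1 := mul_le_mul_of_nonneg_left (mul_le_mul hQ hw4 (by positivity) (by positivity))
      (by positivity : 0 ≤ α ^ 3)
    refine le_trans (b := α ^ 3 * ((1 / τ) * l ^ 4)) (le_of_eq ?_) ?_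
    · field_simp
      ring
    · have : 0 ≤ (3 * α ^ 2 * Q ^ 2 + 6 * α * Q ^ 3 + α ^ 2) * (1 + l ^ 4) := by positivity
      linarith
  · have a1 := mul_le_mul_of_nonneg_left hw2 (by positivity : 0 ≤ α ^ 2)
    have : 0 ≤ (3 * α ^ 2 * Q ^ 2 + 6 * α * Q ^ 3 + α ^ 3 * Q) * (1 + l ^ 4) := by positivity
    rw [mul_pow]
    linarith

theorem ghs_law_bounds {α l τ Q : ℝ} (hα : 0 < α) (hτ : 0 < τ) (hQ : 1 / τ ≤ Q)
    [IsProbabilityMeasure ((Family.ghs α).law l τ)] :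
    FourthMomentBounds ((Family.ghs α).law l τ) (fun x => x) (α * l)
      ((Family.ghs α).V (α * l) / τ)
      ((6 * α ^ 2 * Q ^ 2 + 10 * α * Q ^ 3 + 2 * α ^ 3 * Q + α ^ 2) * (1 + l ^ 4)) := by
  have hq0 : 0 < 1 / τ := by positivity
  have hQ2 : (1 / τ) ^ 2 ≤ Q ^ 2 := pow_le_pow_left₀ hq0.le hQ 2
  have hQ3 : (1 / τ) ^ 3 ≤ Q ^ 3 := pow_le_pow_left₀ hq0.le hQ 3
  have hQ0 : 0 < Q := hq0.trans_le hQ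
  have hsq : 0 ≤ l ^ 2 := sq_nonneg l
  have hw2 : l ^ 2 ≤ 1 + l ^ 4 := by nlinarith [sq_nonneg (l ^ 2 - 1), sq_nonneg (l ^ 2)]
  have hw4 : l ^ 4 ≤ 1 + l ^ 4 := by linarith
  have hw0 : 0 ≤ 1 + l ^ 4 := by positivity
  have hb1 : (1 + l ^ 2) ^ 2 ≤ 2 * (1 + l ^ 4) := by nlinarith [sq_nonneg (l ^ 2 - 1)]
  have hb2 : (1 + l ^ 2) * (2 + 6 * l ^ 2) ≤ 10 * (1 + l ^ 4) := by
    nlinarith [sq_nonneg (l ^ 2 - 1)]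
  have ha : 0 < τ * α := by positivity
  have p0 : IsProbabilityMeasure ((ghsMeasure (τ * α) l).map fun x => x / τ) :=
    ‹IsProbabilityMeasure ((Family.ghs α).law l τ)›
  have p1 : IsProbabilityMeasure (ghsMeasure (τ * α) l) :=
    Measure.isProbabilityMeasure_of_map fun x => x / τ
  refine (rawMoments_ghs ha).fourthMomentBounds (t := τ) ?_ ?_ ?_ ?_ ?_
  · field_simp
  · simp only [Family.V, Family.nu0, Family.nu1, Family.nu2]
    field_simp
    ring
  · have a1 := mul_le_mul_of_nonneg_left (mul_le_mul hQ2 hb1 (by positivity) (by positivity))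
      (by positivity : 0 ≤ 3 * α ^ 2)
    have a2 := mul_le_mul_of_nonneg_left (mul_le_mul hQ3 hb2 (by positivity) (by positivity))
      (by positivity : 0 ≤ α)
    refine le_trans (b := 3 * α ^ 2 * ((1 / τ) ^ 2 * (1 + l ^ 2) ^ 2) +
      α * ((1 / τ) ^ 3 * ((1 + l ^ 2) * (2 + 6 * l ^ 2)))) (le_of_eq ?_) ?_
    · field_simp
      ring
    · have : 0 ≤ (2 * α ^ 3 * Q + α ^ 2) * (1 + l ^ 4) := by positivity
      linarith
  · simp only [Family.V, Family.nu0, Family.nu1, Family.nu2]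
    have a1 := mul_le_mul_of_nonneg_left (mul_le_mul hQ
      (show l ^ 2 + l ^ 4 ≤ 2 * (1 + l ^ 4) by linarith) (by positivity) (by positivity))
      (by positivity : 0 ≤ α ^ 3)
    refine le_trans (b := α ^ 3 * ((1 / τ) * (l ^ 2 + l ^ 4))) (le_of_eq ?_) ?_
    · field_simp
      ring
    · have : 0 ≤ (6 * α ^ 2 * Q ^ 2 + 10 * α * Q ^ 3 + α ^ 2) * (1 + l ^ 4) := by positivity
      linarith
  · have a1 := mul_le_mul_of_nonneg_left hw2 (by positivity : 0 ≤ α ^ 2)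
    have : 0 ≤ (6 * α ^ 2 * Q ^ 2 + 10 * α * Q ^ 3 + 2 * α ^ 3 * Q) * (1 + l ^ 4) := by positivity
    rw [mul_pow]
    linarith

theorem binomial_law_bounds {ξ τ : ℝ} (hτ : ∃ n : ℕ, 1 ≤ n ∧ τ = n) (hξ0 : 0 ≤ ξ) (hξ1 : ξ ≤ 1) :
    FourthMomentBounds (Family.binomial.law ξ τ) (fun x => x) ξ (Family.binomial.V ξ / τ) 1 := by
  obtain ⟨n, hn, rfl⟩ := hτ
  have h := fourthMomentBounds_binomial hn ⟨ξ, hξ0, hξ1⟩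
  have e : Family.binomial.V ξ = ξ * (1 - ξ) := by
    simp only [Family.V, Family.nu0, Family.nu1, Family.nu2]
    ring
  rw [e]
  simpa only [Family.law, Family.totalLaw, Nat.floor_natCast,
    Set.projIcc_of_mem zero_le_one (⟨hξ0, hξ1⟩ : ξ ∈ Set.Icc (0 : ℝ) 1)] using h

end NEFQVF

theorem theorem7 {Ω : Type*} [MeasurableSpace Ω] (P : Measure Ω) [IsProbabilityMeasure P]
    (F : NEFQVF.Family) (ξ τ : ℕ → ℝ) (Y : ℕ → Ω → ℝ)
    (hadm : ∀ i, F.Admissible (ξ i) (τ i))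
    (hcond : F.Conditions ξ τ)
    (hindep : iIndepFun Y P)
    (hlaw : ∀ i, HasLaw (Y i) (F.law (ξ i) (τ i)) P) :
    (∀ (p : ℕ) (ω : Ω), BddAbove (Set.range fun γ : Set.Ici (0 : ℝ) =>
      NEFQVF.discrepancy F p (fun i => F.mean (ξ i)) τ (fun i => Y i ω) γ)) ∧
    (∀ p : ℕ, Integrable
      (fun ω => NEFQVF.supDiscrepancy F p (fun i => F.mean (ξ i)) τ (fun i => Y i ω)) P) ∧
    Tendsto (fun p : ℕ => eLpNorm
      (fun ω => NEFQVF.supDiscrepancy F p (fun i => F.mean (ξ i)) τ (fun i => Y i ω)) 1 P)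
      atTop (𝓝 0) ∧
    TendstoInMeasure P
      (fun (p : ℕ) ω => NEFQVF.supDiscrepancy F p (fun i => F.mean (ξ i)) τ (fun i => Y i ω))
      atTop (fun _ => 0) := by
  have hτ : ∀ i, 0 < τ i := by
    intro i
    have h := hadm i
    cases F with
    | binomial =>
      obtain ⟨⟨n, hn, he⟩, -⟩ := h
      rw [he]
      exact_mod_cast hn
    | poisson => exact h.1
    | negBinomial => exact h.1
    | gamma α => exact h.2.1
    | ghs α => exact h.2
  refine ⟨fun p ω => NEFQVF.bddAbove_discrepancy F p _ τ _ hτ, ?_⟩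
  have hprob : ∀ i, IsProbabilityMeasure (F.law (ξ i) (τ i)) := fun i =>
    (hlaw i).isProbabilityMeasure_iff.1 inferInstance
  cases F with
  | binomial =>
    refine NEFQVF.sequenceBounds_conclusion (F := .binomial) (A := fun _ => 1) (c := 1) hτ ?_ ?_ ?_
      hindep (fun i => .of_hasLaw (hlaw i)
        (NEFQVF.binomial_law_bounds (hadm i).1 (hadm i).2.1 (hadm i).2.2)) ?_
    · intro i
      have := hcond i
      simp only [NEFQVF.Family.nu2]
      linarith
    · intro i
      have := hcond i
      simp only [NEFQVF.Family.nu1, NEFQVF.Family.nu2]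
      rw [abs_div, abs_one, abs_of_pos (by linarith), div_le_one (by linarith)]
      linarith
    · intro i
      have := hcond i
      simp only [NEFQVF.Family.nu2]
      rw [abs_div, abs_neg, abs_one, abs_of_pos (by linarith), div_le_one (by linarith)]
      linarith
    · simpa using isBigO_refl (fun p : ℕ => (p : ℝ)) atTop
  | poisson =>
    obtain ⟨⟨c, hc, hcτ⟩, -, hO⟩ := hcond
    have hQ : ∀ i, 1 / τ i ≤ 1 / c := fun i => one_div_le_one_div_of_le hc (hcτ i)
    refine NEFQVF.sequenceBounds_conclusion (F := .poisson) (c := 1 / c) hτ ?_ ?_ ?_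
      hindep (fun i => .of_hasLaw (hlaw i)
        (NEFQVF.poisson_law_bounds (hadm i).1 (hadm i).2 (hQ i)))
        (NEFQVF.isBigO_const_mul_one_add _ hO)
    · intro i
      simpa only [NEFQVF.Family.nu2, add_zero] using hτ i
    · intro i
      simp only [NEFQVF.Family.nu1, NEFQVF.Family.nu2, add_zero]
      rw [abs_of_pos (one_div_pos.2 (hτ i))]
      exact hQ i
    · intro i
      simp only [NEFQVF.Family.nu2, zero_div, abs_zero]
      positivity
  | negBinomial =>
    obtain ⟨⟨c, hc, hcτ⟩, hO⟩ := hcond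
    have hcτ' : ∀ i, c ≤ τ i := fun i =>
      (hcτ i).trans (mul_le_of_le_one_right (hτ i).le (hadm i).2.2.le)
    have hQ : ∀ i, 1 / τ i ≤ 1 / c := fun i => one_div_le_one_div_of_le hc (hcτ' i)
    have hone : ∀ i, |1 / (τ i + 1)| ≤ 1 := fun i => by
      have := hτ i
      rw [abs_of_pos (by positivity), div_le_one (by positivity)]
      linarith
    refine NEFQVF.sequenceBounds_conclusion (F := .negBinomial) (c := 1) hτ ?_ hone hone
      hindep (fun i => .of_hasLaw (hlaw i)
        (have := hprob i
        NEFQVF.negBinomial_law_bounds (hadm i).1 (hadm i).2.1 (hadm i).2.2 (hQ i)))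
        (NEFQVF.isBigO_const_mul_one_add _ hO)
    intro i
    have := hτ i
    simp only [NEFQVF.Family.nu2]
    positivity
  | gamma α =>
    obtain ⟨⟨c, hc, hcτ⟩, hO⟩ := hcond
    have hα : 0 < α := (hadm 0).1
    have hQ : ∀ i, 1 / τ i ≤ 1 / c := fun i => one_div_le_one_div_of_le hc (hcτ i)
    refine NEFQVF.sequenceBounds_conclusion (F := .gamma α) (c := 1) hτ ?_ ?_ ?_
      hindep (fun i => .of_hasLaw (hlaw i)
        (NEFQVF.gamma_law_bounds hα (hτ i) (hadm i).2.2 (hQ i)))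
        (NEFQVF.isBigO_const_mul_one_add _ hO)
    · intro i
      have := hτ i
      simp only [NEFQVF.Family.nu2]
      positivity
    · intro i
      simp [NEFQVF.Family.nu1]
    · intro i
      have h1 := hτ i
      simp only [NEFQVF.Family.nu2]
      rw [abs_of_pos (by positivity), div_le_one (by positivity)]
      linarith
  | ghs α =>
    obtain ⟨⟨c, hc, hcτ⟩, hO⟩ := hcond
    have hα : 0 < α := (hadm 0).1
    have hQ : ∀ i, 1 / τ i ≤ 1 / c := fun i => one_div_le_one_div_of_le hc (hcτ i)
    refine NEFQVF.sequenceBounds_conclusion (F := .ghs α) (c := 1) hτ ?_ ?_ ?_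
      hindep (fun i => .of_hasLaw (hlaw i)
        (have := hprob i
        NEFQVF.ghs_law_bounds hα (hτ i) (hQ i)))
        (NEFQVF.isBigO_const_mul_one_add _ hO)
    · intro i
      have := hτ i
      simp only [NEFQVF.Family.nu2]
      positivity
    · intro i
      simp [NEFQVF.Family.nu1]
    · intro i
      have h1 := hτ i
      simp only [NEFQVF.Family.nu2]
      rw [abs_of_pos (by positivity), div_le_one (by positivity)]
      linarith
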